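/- Let $0<a_1<a_2<a_3$ and $c\in(a_1,a_3)\setminus\{a_2\}$ be real numbers, and let $$\Gamma:\ \mu^2=-\lambda(\lambda-c)(\lambda-a_1)(\lambda-a_2)(\lambda-a_3)=-\lambda\prod_{k=1}^4(\lambda-b_k),\qquad 0<b_1<b_2<b_3<b_4,$$ be the genus two curve associated to the geodesics on the triaxial ellipsoid $X_1^2/a_1+X_2^2/a_2+X_3^2/a_3=1$ with caustic parameter $c$. Put $\omega_1=d\lambda/\mu$, $\omega_2=\lambda\,d\lambda/\mu$, $P_0=(0,0)\in\Gamma$, and let $\alpha_1,\alpha_2$ be the real cycles around $[b_1,b_2]$ and $[b_3,b_4]$, oriented so that $\oint_{\alpha_i}\omega_j=2\int_{b_{2i-1}}^{b_{2i}}\lambda^{j-1}\,d\lambda\big/\sqrt{-\lambda\prod_k(\lambda-b_k)}>0$. The period mapping is $$\varphi(c)=\frac{2\oint_{\alpha_2}\omega_2}{2\oint_{\alpha_1}\omega_2}\ \text{ if } a_1<c<a_2,\qquad \varphi(c)=\frac{2\oint_{\alpha_1}\omega_2}{2\oint_{\alpha_2}\omega_2}\ \text{ if } a_2<c<a_3 .$$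 Assume that $(\Gamma,P_0)$ is a $3:1$ hyperelliptic tangential cover, i.e. there is a covering $\pi:\Gamma\to\mathcal E$ of degree $3$ onto an elliptic curve $\mathcal E:\ W^2=4Z^3-g_2Z-g_3$ which sends $P_0$ to the infinite point $Q_0$ of $\mathcal E$ and is such that the canonical map $\mathcal E\to\mathrm{Jac}(\Gamma)$, $Q\mapsto\pi^*(Q-Q_0)$, and the Abel map $\Gamma\to\mathrm{Jac}(\Gamma)$, $P\mapsto\int_{P_0}^P(\omega_1,\omega_2)$, have images tangent at the origin. Then the geodesics with parameter $c$ are closed, in the sense that there are integers $(m_1,m_2)\ne(0,0)$ and $T>0$ with $m_1\oint_{\alpha_1}\omega_1+m_2\oint_{\alpha_2}\omega_1=T$ and $m_1\oint_{\alpha_1}\omega_2+m_2\oint_{\alpha_2}\omega_2=0$, and their period mapping is $2:1$ or $1:2$: precisely, $\varphi(c)=2$ if $a_1<c<a_2$, and $\varphi(c)=1/2$ if $a_2<c<a_3$. -/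

import Mathlib

open Polynomial

namespace GeodesicCurve

noncomputable section

/-! ### The genus two curve `Γ : μ² = -λ (λ - b₁) (λ - b₂) (λ - b₃) (λ - b₄)`

The finite non-zero branch points are `b 0, b 1, b 2, b 3`, standing for `b₁, b₂, b₃, b₄`.
Similarly the differentials `ω₁, ω₂` and the cycles `α₁, α₂` are indexed by `0, 1 : Fin 2`. -/

/-- The polynomial `-λ ∏ₖ (λ - bₖ)`. -/
def curvePoly (b : Fin 4 → ℝ) : ℂ[X] := -(X * ∏ k, (X - C (b k : ℂ)))

/-- The polynomial `Y² - (-λ ∏ₖ (λ - bₖ))` in `Y` over `ℂ(λ)`. -/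
def definingPoly (b : Fin 4 → ℝ) : (RatFunc ℂ)[X] :=
  X ^ 2 - C (algebraMap ℂ[X] (RatFunc ℂ) (curvePoly b))

theorem natDegree_curvePoly (b : Fin 4 → ℝ) : (curvePoly b).natDegree = 5 := by
  have h : (∏ k, (X - C (b k : ℂ))).Monic := monic_prod_of_monic _ _ fun k _ => monic_X_sub_C _
  rw [curvePoly, natDegree_neg, natDegree_X_mul h.ne_zero,
    natDegree_prod_of_monic _ _ fun k _ => monic_X_sub_C _]
  simp

theorem irreducible_definingPoly (b : Fin 4 → ℝ) : Irreducible (definingPoly b) := by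
  refine X_pow_sub_C_irreducible_of_prime Nat.prime_two fun r hr => ?_
  obtain ⟨g, rfl⟩ := IsIntegrallyClosed.exists_algebraMap_eq_of_isIntegral_pow
    (R := ℂ[X]) (x := r) (n := 2) (by norm_num) (hr ▸ isIntegral_algebraMap)
  rw [← map_pow] at hr
  have h := congrArg natDegree (IsFractionRing.injective ℂ[X] (RatFunc ℂ) hr)
  rw [natDegree_pow, natDegree_curvePoly] at h
  omega

instance (b : Fin 4 → ℝ) : Fact (Irreducible (definingPoly b)) := ⟨irreducible_definingPoly b⟩

/-- The field of meromorphic functions `ℂ(Γ) = ℂ(λ)[μ]`. -/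
def FunctionField (b : Fin 4 → ℝ) : Type := AdjoinRoot (definingPoly b)

instance (b : Fin 4 → ℝ) : Field (FunctionField b) :=
  inferInstanceAs (Field (AdjoinRoot (definingPoly b)))

instance (b : Fin 4 → ℝ) : Algebra (RatFunc ℂ) (FunctionField b) :=
  inferInstanceAs (Algebra (RatFunc ℂ) (AdjoinRoot (definingPoly b)))

instance (b : Fin 4 → ℝ) : Algebra ℂ (FunctionField b) :=
  inferInstanceAs (Algebra ℂ (AdjoinRoot (definingPoly b)))

instance (b : Fin 4 → ℝ) : IsScalarTower ℂ (RatFunc ℂ) (FunctionField b) :=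
  inferInstanceAs (IsScalarTower ℂ (RatFunc ℂ) (AdjoinRoot (definingPoly b)))

/-- The coordinate function `λ` on `Γ`. -/
def lam (b : Fin 4 → ℝ) : FunctionField b := algebraMap (RatFunc ℂ) (FunctionField b) RatFunc.X

/-- The coordinate function `μ` on `Γ`. -/
def mu (b : Fin 4 → ℝ) : FunctionField b := AdjoinRoot.root (definingPoly b)

/-- The holomorphic differentials `ω₁ = dλ/μ` (`j = 0`) and `ω₂ = λ dλ/μ` (`j = 1`), as elements
of the module of differentials of `ℂ(Γ)`. -/
def omega (b : Fin 4 → ℝ) (j : Fin 2) : Ω[FunctionField b⁄ℂ] :=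
  (lam b ^ (j : ℕ) / mu b) • KaehlerDifferential.D ℂ (FunctionField b) (lam b)

/-- `h` has a pole at `P₀ = (0,0)`: `h = q/p` with polynomials `p, q` in `λ, μ` such that
`p(P₀) = 0` and `q(P₀) ≠ 0`. -/
def HasPoleAtP0 (b : Fin 4 → ℝ) (h : FunctionField b) : Prop :=
  ∃ p q : MvPolynomial (Fin 2) ℂ, MvPolynomial.eval 0 p = 0 ∧ MvPolynomial.eval 0 q ≠ 0 ∧
    h * MvPolynomial.aeval ![lam b, mu b] p = MvPolynomial.aeval ![lam b, mu b] q

/-- The tangent vector `U = (A, 0)`, `A = 2 / √(-b₁ b₂ b₃ b₄)`, at the origin of the image of `Γ`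
under the Abel map `P ↦ ∫_{P₀}^P (ω₁, ω₂)`, with respect to the local coordinate `τ = √λ`
at `P₀`. -/
def tangentVector (b : Fin 4 → ℝ) : Fin 2 → ℂ :=
  ![2 / (Complex.I * (√(∏ k, b k) : ℝ)), 0]

/-! ### Coverings of elliptic curves -/

/-- A covering `π : Γ → 𝓔` of an elliptic curve `𝓔 : W² = 4 Z³ - g₂ Z - g₃` by a complex algebraic
curve `Γ` with function field `K`: a non-constant point of `𝓔` over `K`. Here `Z` and `W` are the
pull-backs of the coordinate functions of `𝓔`. -/
structure EllipticCover (K : Type) [Field K] [Algebra ℂ K] where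
  g₂ : ℂ
  g₃ : ℂ
  disc_ne_zero : g₂ ^ 3 - 27 * g₃ ^ 2 ≠ 0
  Z : K
  W : K
  equation : W ^ 2 = 4 * Z ^ 3 - algebraMap ℂ K g₂ * Z - algebraMap ℂ K g₃
  nonconstant : ∀ z : ℂ, Z ≠ algebraMap ℂ K z

namespace EllipticCover

/-- The function field `ℂ(Z, W)` of `𝓔`, as a subfield of that of `Γ`. -/
def baseField {K : Type} [Field K] [Algebra ℂ K] (π : EllipticCover K) : IntermediateField ℂ K :=
  IntermediateField.adjoin ℂ {π.Z, π.W}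

/-- The degree of the covering. -/
def degree {K : Type} [Field K] [Algebra ℂ K] (π : EllipticCover K) : ℕ :=
  Module.finrank π.baseField K

/-- The pull-back to `Γ` of the holomorphic differential `du = dZ/W` of `𝓔`. -/
def du {K : Type} [Field K] [Algebra ℂ K] (π : EllipticCover K) : Ω[K⁄ℂ] :=
  π.W⁻¹ • KaehlerDifferential.D ℂ K π.Z

/-- `π` maps `P₀` to the infinite point `Q₀` of `𝓔`. -/
def IsPointed {b : Fin 4 → ℝ} (π : EllipticCover (FunctionField b)) : Prop := HasPoleAtP0 b π.Z

/-- `π` is tangential at `P₀`. The canonical map `𝓔 → Jac Γ`, `Q ↦ π^*(Q - Q₀)`, is given by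
`Q ↦ ∑_{P ∈ π⁻¹(Q)} ∫_{P₀}^P (ω₁, ω₂)` up to a translation. By differentiation, its tangent vector
with respect to the coordinate `u` has the components `∑_{P ∈ π⁻¹(Q)} (ωⱼ/du)(P)`, that is, the
traces from `ℂ(Γ)` to `ℂ(𝓔)` of the functions `ωⱼ/du`. It is required that this vector be a
non-zero multiple of the tangent vector `U` of `Γ`, so that the canonical map is `u ↦ u U` after
rescaling `u` and the images of `𝓔` and `Γ` are tangent at the origin. -/
def IsTangential {b : Fin 4 → ℝ} (π : EllipticCover (FunctionField b)) : Prop :=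
  ∃ c : ℂ, c ≠ 0 ∧ ∀ j : Fin 2, ∃ h : FunctionField b, omega b j = h • π.du ∧
    Algebra.trace π.baseField (FunctionField b) h =
      algebraMap ℂ π.baseField (c * tangentVector b j)

end EllipticCover

/-- `(Γ, P₀)` is a hyperelliptic tangential cover of degree `N`. -/
def IsHyperellipticTangentialCover (b : Fin 4 → ℝ) (N : ℕ) : Prop :=
  ∃ π : EllipticCover (FunctionField b), π.degree = N ∧ π.IsPointed ∧ π.IsTangential

/-! ### Real periods -/

/-- `∮_{αᵢ} ωⱼ`. The cycle `α₁` (`i = 0`) goes round `[b₁, b₂]` and `α₂` (`i = 1`) goes round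
`[b₃, b₄]`; on these intervals `-λ ∏ₖ (λ - bₖ) ≥ 0`, and both cycles are oriented so that the
periods are positive. -/
def alphaPeriod (b : Fin 4 → ℝ) (i j : Fin 2) : ℝ :=
  2 * ∫ x in (![b 0, b 2] i)..(![b 1, b 3] i), x ^ (j : ℕ) / √(-(x * ∏ k, (x - b k)))

/-- The closedness condition of real geodesics: some non-trivial integer combination of `α₁, α₂`
has a positive period `T` of `ω₁` and zero period of `ω₂`. -/
def IsHill (b : Fin 4 → ℝ) : Prop :=
  ∃ m : Fin 2 → ℤ, m ≠ 0 ∧ ∃ T : ℝ, 0 < T ∧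
    ∑ i, (m i : ℝ) * alphaPeriod b i 0 = T ∧ ∑ i, (m i : ℝ) * alphaPeriod b i 1 = 0

/-! ### Geodesics on triaxial ellipsoids -/

/-- The branch points `b₁ < b₂ < b₃ < b₄` of the curve
`Γ : μ² = -λ (λ - c) (λ - a₁) (λ - a₂) (λ - a₃)` attached to the geodesics on the ellipsoid
`X₁²/a₁ + X₂²/a₂ + X₃²/a₃ = 1` with caustic parameter `c ∈ (a₁, a₃) \ {a₂}`. -/
def branchPoints (a₁ a₂ a₃ c : ℝ) : Fin 4 → ℝ :=
  if c < a₂ then ![a₁, c, a₂, a₃] else ![a₁, a₂, c, a₃]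

/-- The period mapping `φ(c)` of the geodesics with caustic parameter `c`: the ratio
`2∮_{α₂} ω₂ : 2∮_{α₁} ω₂` if `a₁ < c < a₂`, and `2∮_{α₁} ω₂ : 2∮_{α₂} ω₂` if `a₂ < c < a₃`. -/
def periodMapping (a₁ a₂ a₃ c : ℝ) : ℝ :=
  if c < a₂ then
    (2 * alphaPeriod (branchPoints a₁ a₂ a₃ c) 1 1) / (2 * alphaPeriod (branchPoints a₁ a₂ a₃ c) 0 1)
  else
    (2 * alphaPeriod (branchPoints a₁ a₂ a₃ c) 0 1) / (2 * alphaPeriod (branchPoints a₁ a₂ a₃ c) 1 1)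

end

end GeodesicCurve

/-! Put x = 1/λ and y = μ/λ³. Then Γ becomes y² = g(x), where g is a squarefree quintic with roots 0
and 1/b_k; P₀ becomes the Weierstrass point at infinity, and ω₂ = -dx/y. As the second component of
`tangentVector` is 0, tangency gives Tr(ω₂/du) = 0.

A cover sending P₀ to Q₀ is compatible with the two involutions, and since its degree is odd this
forces Z = N(x)/D(x) and W = y T(x)/D(x)², with deg N = 3, deg D ≤ 2 and g T² = D F(N, D), F being
the homogenized cubic (`exists_normal_form`). The polynomial T divides the Wronskian of N and D
(`dvd_wronsk`), say with quotient l, and ω₂/du = -1/l. Counting degrees leaves l constant or linear.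
A nonzero constant has nonzero trace, so l = κ(x - ρ) and deg D = 2. The vanishing of Tr(1/(x - ρ))
then removes the linear terms of N and D at ρ (`linear_coeff_eq_zero`), and comparing coefficients
gives g = γ((x-ρ)² - s²)((x-ρ)³ - (3/4)s²(x-ρ) + c) (`branch_poly_of_centred`).

The roots of g are real, and ρ ± s turn out to be the outermost ones, 0 and 1/b₁
(`quadratic_relations`). The cubic factor is the triple angle polynomial: with 1/λ = M(1 + cos θ)
the points b₁, ..., b₄ sit at θ = 0, a, 2π/3 - a, 2π/3 + a, and ω₂ becomes a constant multiple of
dθ/√(cos 3θ - cos 3a). This is even and 2π/3-periodic, so its integral over the second interval is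
twice that over the first (`periods_angleBranchPoints`). Hence 2α₁ - α₂ has zero ω₂-period; its
ω₁-period is positive because ω₁ = ω₂/λ and b₂ < b₃. -/

namespace GeodesicCurve

/-! ### Wronskians and points of elliptic curves over ℂ(x) -/

/-- The homogenized Weierstrass cubic `4 N³ - g₂ N D² - g₃ D³` evaluated at two polynomials. -/
noncomputable def weierstrassForm (g₂ g₃ : ℂ) (N D : ℂ[X]) : ℂ[X] :=
  4 * N ^ 3 - C g₂ * N * D ^ 2 - C g₃ * D ^ 3

/-- The Wronskian of two polynomials. -/
noncomputable def wronsk (N D : ℂ[X]) : ℂ[X] := derivative N * D - N * derivative D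

theorem derivative_weierstrassForm (g₂ g₃ : ℂ) (N D : ℂ[X]) :
    derivative (weierstrassForm g₂ g₃ N D) =
      (12 * N ^ 2 - C g₂ * D ^ 2) * derivative N
        - (2 * C g₂ * N * D + 3 * C g₃ * D ^ 2) * derivative D := by
  simp only [weierstrassForm, derivative_sub, derivative_mul, derivative_C, derivative_pow,
    derivative_ofNat, map_natCast]
  push_cast
  ring

/-- Let H = D F(N, D), a binary quartic form in N, D. T divides both H and its derivative, so
Euler's identity N H_N + D H_D = 4H shows that T divides H_N w and H_D w, where w is the Wronskian.
Nonzero discriminant makes H_N and H_D coprime. Geometrically, the pull-back of du has no poles at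
the zeros of T. -/
theorem dvd_wronsk {g₂ g₃ : ℂ} (hΔ : g₂ ^ 3 - 27 * g₃ ^ 2 ≠ 0) {N D g T : ℂ[X]}
    (hND : IsCoprime N D) (h : g * T ^ 2 = D * weierstrassForm g₂ g₃ N D) :
    T ∣ wronsk N D := by
  have hd := congrArg derivative h
  rw [derivative_mul, derivative_mul, derivative_weierstrassForm, derivative_pow] at hd
  simp only [Nat.add_one_sub_one, pow_one, Nat.cast_ofNat, map_ofNat] at hd
  have h1 : T ∣ D * (12 * N ^ 2 - C g₂ * D ^ 2) * wronsk N D := by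
    refine ⟨D * (derivative g * T + g * (2 * derivative T)) - 4 * g * T * derivative D, ?_⟩
    rw [wronsk]
    rw [weierstrassForm] at h hd
    linear_combination (-D) * hd + 4 * derivative D * h
  have h2 : T ∣ (4 * N ^ 3 - 3 * C g₂ * N * D ^ 2 - 4 * C g₃ * D ^ 3) * wronsk N D := by
    refine ⟨-(N * (derivative g * T + g * (2 * derivative T)) - 4 * g * T * derivative N), ?_⟩
    rw [wronsk]
    rw [weierstrassForm] at h hd
    linear_combination N * hd - 4 * derivative N * h
  -- Elimination of N between H_N and H_D leaves a multiple of the discriminant times D⁵; that power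
  -- of D is then removed because H_D ≡ 4N³ modulo D.
  have h3 : T ∣ wronsk N D * D ^ 5 := by
    have h4 : T ∣ C (4 * (g₂ ^ 3 - 27 * g₃ ^ 2)) * (wronsk N D * D ^ 5) := by
      have := ((h1.mul_left (N * (6 * C g₂ * N - 9 * C g₃ * D) - 4 * C g₂ ^ 2 * D ^ 2))).sub
        (h2.mul_left (3 * D * (6 * C g₂ * N - 9 * C g₃ * D)))
      convert this using 1
      simp only [map_mul, map_sub, map_pow, map_ofNat]
      ring
    refine (IsUnit.dvd_mul_left ?_).1 h4
    exact isUnit_C.2 (isUnit_iff_ne_zero.2 (mul_ne_zero (by norm_num) hΔ))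
  have hco : IsCoprime (D ^ 5) (4 * N ^ 3 - 3 * C g₂ * N * D ^ 2 - 4 * C g₃ * D ^ 3) := by
    have h4 : IsCoprime D (4 * N ^ 3) := by
      have : IsUnit (4 : ℂ[X]) := by
        have := (isUnit_C (x := (4 : ℂ))).2 (by norm_num)
        rwa [map_ofNat] at this
      exact (isCoprime_mul_unit_left_right this _ _).2 (hND.symm.pow_right)
    have h5 := h4.add_mul_left_right (- (3 * C g₂ * N * D) - 4 * C g₃ * D ^ 2)
    refine IsCoprime.pow_left ?_
    rwa [show 4 * N ^ 3 - 3 * C g₂ * N * D ^ 2 - 4 * C g₃ * D ^ 3 =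
      4 * N ^ 3 + D * (- (3 * C g₂ * N * D) - 4 * C g₃ * D ^ 2) by ring]
  obtain ⟨u, v, huv⟩ := hco
  have : wronsk N D = u * (wronsk N D * D ^ 5)
      + v * ((4 * N ^ 3 - 3 * C g₂ * N * D ^ 2 - 4 * C g₃ * D ^ 3) * wronsk N D) := by
    linear_combination (-wronsk N D) * huv
  rw [this]
  exact (h3.mul_left _).add (h2.mul_left _)

theorem natDegree_wronsk_lt {N D : ℂ[X]} (h : wronsk N D ≠ 0) :
    (wronsk N D).natDegree < N.natDegree + D.natDegree := by
  have hN : N.natDegree + D.natDegree ≠ 0 := by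
    intro h0
    obtain ⟨a, rfl⟩ := natDegree_eq_zero.1 (Nat.eq_zero_of_add_eq_zero_right h0)
    obtain ⟨b, rfl⟩ := natDegree_eq_zero.1 (Nat.eq_zero_of_add_eq_zero_left h0)
    simp [wronsk] at h
  by_cases hN0 : N.natDegree = 0
  · obtain ⟨a, rfl⟩ := natDegree_eq_zero.1 hN0
    simp only [wronsk, derivative_C, zero_mul, zero_sub, natDegree_neg, natDegree_C, zero_add]
    refine (natDegree_C_mul_le _ _).trans_lt (natDegree_derivative_lt ?_)
    simpa using hN
  by_cases hD0 : D.natDegree = 0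
  · obtain ⟨a, rfl⟩ := natDegree_eq_zero.1 hD0
    simp only [wronsk, derivative_C, mul_zero, sub_zero, natDegree_C, add_zero]
    exact (natDegree_mul_C_le _ _).trans_lt (natDegree_derivative_lt hN0)
  have h1 := natDegree_derivative_lt hN0
  have h2 := natDegree_derivative_lt hD0
  refine (natDegree_sub_le _ _).trans_lt (max_lt ?_ ?_)
  · exact natDegree_mul_le.trans_lt (by omega)
  · exact natDegree_mul_le.trans_lt (by omega)

theorem natDegree_weierstrassForm_of_lt (g₂ g₃ : ℂ) {N D : ℂ[X]}
    (h : D.natDegree < N.natDegree) :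
    (weierstrassForm g₂ g₃ N D).natDegree = 3 * N.natDegree := by
  have h4 : (4 * N ^ 3 : ℂ[X]).natDegree = 3 * N.natDegree := by
    rw [show (4 : ℂ[X]) = C 4 from (map_ofNat C 4).symm, natDegree_C_mul (by norm_num),
      natDegree_pow]
  have h1 : (C g₂ * N * D ^ 2).natDegree < 3 * N.natDegree := by
    have e1 := natDegree_C_mul_le g₂ N
    have e2 : (D ^ 2).natDegree ≤ 2 * D.natDegree := natDegree_pow_le
    exact (natDegree_mul_le_of_le e1 e2).trans_lt (by omega)
  have h2 : (C g₃ * D ^ 3).natDegree < 3 * N.natDegree := by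
    have e1 := natDegree_C_mul_le g₃ (D ^ 3)
    have e2 : (D ^ 3).natDegree ≤ 3 * D.natDegree := natDegree_pow_le
    omega
  have h5 : (4 * N ^ 3 - C g₂ * N * D ^ 2).natDegree = 3 * N.natDegree := by
    rw [natDegree_sub_eq_left_of_natDegree_lt (by rwa [h4]), h4]
  rw [weierstrassForm, natDegree_sub_eq_left_of_natDegree_lt (by rwa [h5]), h5]

theorem coeff_weierstrassForm (g₂ g₃ : ℂ) {N D : ℂ[X]} {m : ℕ}
    (hN : N.natDegree ≤ m) (hD : D.natDegree ≤ m) :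
    (weierstrassForm g₂ g₃ N D).coeff (3 * m) =
      4 * N.coeff m ^ 3 - g₂ * N.coeff m * D.coeff m ^ 2 - g₃ * D.coeff m ^ 3 := by
  have h3 := natDegree_pow_le_of_le 2 hD
  rw [weierstrassForm, show (4 : ℂ[X]) = C 4 from (map_ofNat C 4).symm, mul_assoc (C g₂),
    coeff_sub, coeff_sub, coeff_C_mul, coeff_C_mul, coeff_C_mul,
    coeff_pow_of_natDegree_le hN, coeff_pow_of_natDegree_le hD, show 3 * m = m + 2 * m by ring,
    coeff_mul_add_eq_of_natDegree_le hN h3, coeff_pow_of_natDegree_le hD]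
  ring

/-- A polynomial parametrization of an elliptic curve is constant. -/
theorem wronsk_eq_zero_of_sq {g₂ g₃ : ℂ} (hΔ : g₂ ^ 3 - 27 * g₃ ^ 2 ≠ 0) {N D T : ℂ[X]}
    (hND : IsCoprime N D) (h : T ^ 2 = D * weierstrassForm g₂ g₃ N D) :
    wronsk N D = 0 := by
  by_contra hw
  obtain ⟨l, hl⟩ := dvd_wronsk hΔ hND (g := 1) (by rw [one_mul, h])
  have hT : T ≠ 0 := by rintro rfl; simp [hl] at hw
  have hl0 : l ≠ 0 := by rintro rfl; simp [hl] at hw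
  have hD0 : D ≠ 0 := by
    rintro rfl
    exact hT (by simpa using h)
  have hlt := natDegree_wronsk_lt hw
  have hTw : T.natDegree ≤ (wronsk N D).natDegree := by
    rw [hl, natDegree_mul hT hl0]; omega
  have hT2 : (T ^ 2).natDegree = 2 * T.natDegree := natDegree_pow _ _
  -- The pull-back of du would be l dx, up to sign a polynomial differential, which has a pole at
  -- infinity. If Z has a pole at infinity, the degrees already clash; otherwise the value α/δ of Z
  -- there is shown to be a double root of the cubic.
  rcases lt_or_ge D.natDegree N.natDegree with hlt' | hle
  · have h3 := natDegree_weierstrassForm_of_lt g₂ g₃ hlt'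
    have hF : weierstrassForm g₂ g₃ N D ≠ 0 := by
      intro h0; rw [h0, mul_zero] at h; exact hT (by simpa using h)
    rw [h, natDegree_mul hD0 hF, h3] at hT2
    omega
  set m := D.natDegree with hm
  have hF : weierstrassForm g₂ g₃ N D ≠ 0 := by
    intro h0; rw [h0, mul_zero] at h; exact hT (by simpa using h)
  have hdF : (weierstrassForm g₂ g₃ N D).natDegree < 3 * m := by
    rw [h, natDegree_mul hD0 hF] at hT2
    omega
  have hc1 : 4 * N.coeff m ^ 3 - g₂ * N.coeff m * D.coeff m ^ 2 - g₃ * D.coeff m ^ 3 = 0 := by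
    rw [← coeff_weierstrassForm g₂ g₃ hle le_rfl]
    exact coeff_eq_zero_of_natDegree_lt hdF
  -- This is dW = (6Z² - g₂/2) dZ/W with Z = N/D, W = T/D² and denominators cleared.
  have hid : 2 * (derivative T * D - 2 * T * derivative D) =
      D * (12 * N ^ 2 - C g₂ * D ^ 2) * l := by
    refine mul_left_cancel₀ hT ?_
    have hd := congrArg derivative h
    rw [derivative_mul, derivative_weierstrassForm, derivative_pow] at hd
    simp only [Nat.add_one_sub_one, pow_one, Nat.cast_ofNat, map_ofNat] at hd
    rw [wronsk] at hl
    rw [weierstrassForm] at h hd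
    linear_combination D * hd + D * (12 * N ^ 2 - C g₂ * D ^ 2) * hl - 4 * derivative D * h
  have hc2 : 12 * N.coeff m ^ 2 - g₂ * D.coeff m ^ 2 = 0 := by
    have hcoeff : (12 * N ^ 2 - C g₂ * D ^ 2).coeff (2 * m) =
        12 * N.coeff m ^ 2 - g₂ * D.coeff m ^ 2 := by
      rw [show (12 : ℂ[X]) = C 12 from (map_ofNat C 12).symm, coeff_sub, coeff_C_mul,
        coeff_C_mul, coeff_pow_of_natDegree_le hle, coeff_pow_of_natDegree_le le_rfl]
    rw [← hcoeff]
    by_contra hne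
    have hE : (12 * N ^ 2 - C g₂ * D ^ 2 : ℂ[X]) ≠ 0 := by
      intro h0; rw [h0, coeff_zero] at hne; exact hne rfl
    have hdeg := le_natDegree_of_ne_zero hne
    have h5 : (D * (12 * N ^ 2 - C g₂ * D ^ 2) * l).natDegree ≥ 3 * m := by
      rw [natDegree_mul (mul_ne_zero hD0 hE) hl0, natDegree_mul hD0 hE]
      omega
    rw [← hid] at h5
    have hm0 : m ≠ 0 := by omega
    have h6 : (derivative T * D - 2 * T * derivative D).natDegree < 3 * m := by
      refine (natDegree_sub_le _ _).trans_lt (max_lt ?_ ?_)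
      · refine natDegree_mul_le.trans_lt ?_
        have := natDegree_derivative_le T
        omega
      · have h7 := natDegree_derivative_lt hm0
        have h8 : (2 * T).natDegree ≤ T.natDegree := by
          rw [show (2 : ℂ[X]) = C 2 from (map_ofNat C 2).symm]
          exact natDegree_C_mul_le _ _
        refine natDegree_mul_le.trans_lt ?_
        omega
    have h9 : (2 * (derivative T * D - 2 * T * derivative D)).natDegree ≤
        (derivative T * D - 2 * T * derivative D).natDegree := by
      rw [show (2 : ℂ[X]) = C 2 from (map_ofNat C 2).symm]
      exact natDegree_C_mul_le _ _
    omega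
  have hδ : D.coeff m ≠ 0 := leadingCoeff_ne_zero.2 hD0
  set α := N.coeff m
  set δ := D.coeff m
  -- The cubic and its derivative vanish together, so the discriminant does.
  refine mul_ne_zero hΔ (pow_ne_zero 5 hδ) ?_
  linear_combination (4⁻¹ * α * (6 * g₂ * α - 9 * g₃ * δ) - g₂ ^ 2 * δ ^ 2) * δ * hc2
    - (3 / 4) * δ * (6 * g₂ * α - 9 * g₃ * δ) * (4 * hc1 - α * hc2)

theorem exists_eq_C_of_wronsk_eq_zero {N D : ℂ[X]} (hND : IsCoprime N D)
    (h : wronsk N D = 0) : ∃ a b : ℂ, N = C a ∧ D = C b := by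
  have h1 : derivative N * D = N * derivative D := sub_eq_zero.1 h
  have h2 : D ∣ derivative D := hND.symm.dvd_of_dvd_mul_left ⟨derivative N, by rw [← h1, mul_comm]⟩
  have h3 : N ∣ derivative N := hND.dvd_of_dvd_mul_right ⟨derivative D, h1⟩
  have key : ∀ P : ℂ[X], P ∣ derivative P → ∃ a, P = C a := by
    intro P hP
    by_cases hd : P.natDegree = 0
    · exact ⟨_, eq_C_of_natDegree_eq_zero hd⟩
    · have := derivative_eq_zero.1
        (eq_zero_of_dvd_of_natDegree_lt hP (natDegree_derivative_lt hd))
      exact absurd this hd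
  obtain ⟨a, ha⟩ := key N h3
  obtain ⟨b, hb⟩ := key D h2
  exact ⟨a, b, ha, hb⟩

/-! ### Degrees of rational functions and constancy of points over ℂ(x) -/

theorem intDegree_add_eq_left_of_lt {x y : RatFunc ℂ} (hx : x ≠ 0)
    (h : y.intDegree < x.intDegree) : (x + y).intDegree = x.intDegree := by
  by_cases hy : y = 0
  · rw [hy, add_zero]
  have hxy : x + y ≠ 0 := by
    intro h0
    rw [eq_neg_of_add_eq_zero_left h0, RatFunc.intDegree_neg] at h
    exact lt_irrefl _ h
  have h1 := RatFunc.intDegree_add_le hy hxy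
  have h2 := RatFunc.intDegree_add_le (x := x + y) (y := -y) (neg_ne_zero.2 hy) (by simpa using hx)
  rw [RatFunc.intDegree_neg, add_neg_cancel_right] at h2
  rw [max_eq_left h.le] at h1
  rcases le_max_iff.1 h2 with h3 | h3
  · exact le_antisymm h1 h3
  · exact absurd h (not_lt.2 h3)

theorem intDegree_add_le_of_le {x y : RatFunc ℂ} {n : ℤ} (hn : 0 ≤ n)
    (hx : x.intDegree ≤ n) (hy : y.intDegree ≤ n) : (x + y).intDegree ≤ n := by
  by_cases hy0 : y = 0
  · rwa [hy0, add_zero]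
  by_cases hxy : x + y = 0
  · simpa [hxy] using hn
  exact (RatFunc.intDegree_add_le hy0 hxy).trans (max_le hx hy)

theorem intDegree_C_mul {a : ℂ} (ha : a ≠ 0) (x : RatFunc ℂ) :
    (RatFunc.C a * x).intDegree = x.intDegree := by
  by_cases hx : x = 0
  · simp [hx]
  rw [RatFunc.intDegree_mul (by simpa using ha) hx, RatFunc.intDegree_C, zero_add]

theorem intDegree_C_mul_le {n : ℤ} (hn : 0 ≤ n) (a : ℂ) {x : RatFunc ℂ} (hx : x.intDegree ≤ n) :
    (RatFunc.C a * x).intDegree ≤ n := by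
  by_cases ha : a = 0
  · simpa [ha] using hn
  · rwa [intDegree_C_mul ha]

theorem intDegree_sq (x : RatFunc ℂ) : (x ^ 2).intDegree = 2 * x.intDegree := by
  by_cases hx : x = 0
  · simp [hx]
  rw [sq, RatFunc.intDegree_mul hx hx, two_mul]

/-- Clearing denominators in a point of a quadratic twist of an elliptic curve over `ℂ(x)`. -/
theorem exists_polynomial_of_twisted_point {g₂ g₃ : ℂ} {g N D : ℂ[X]} {S R : RatFunc ℂ}
    (hg : Squarefree g) (hD : D ≠ 0)
    (hR : R = algebraMap ℂ[X] (RatFunc ℂ) N / algebraMap ℂ[X] (RatFunc ℂ) D)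
    (h : algebraMap ℂ[X] (RatFunc ℂ) g * S ^ 2 =
      4 * R ^ 3 - RatFunc.C g₂ * R - RatFunc.C g₃) :
    ∃ T : ℂ[X], S * algebraMap ℂ[X] (RatFunc ℂ) D ^ 2 = algebraMap ℂ[X] (RatFunc ℂ) T ∧
      g * T ^ 2 = D * weierstrassForm g₂ g₃ N D := by
  have hD' : algebraMap ℂ[X] (RatFunc ℂ) D ≠ 0 := RatFunc.algebraMap_ne_zero hD
  have hg' : algebraMap ℂ[X] (RatFunc ℂ) g ≠ 0 := RatFunc.algebraMap_ne_zero hg.ne_zero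
  have hV : algebraMap ℂ[X] (RatFunc ℂ) g * (S * algebraMap ℂ[X] (RatFunc ℂ) D ^ 2) ^ 2 =
      algebraMap ℂ[X] (RatFunc ℂ) (D * weierstrassForm g₂ g₃ N D) := by
    have : R * algebraMap ℂ[X] (RatFunc ℂ) D = algebraMap ℂ[X] (RatFunc ℂ) N := by
      rw [hR, div_mul_cancel₀ _ hD']
    simp only [weierstrassForm, map_mul, map_sub, map_pow, map_ofNat, ← this,
      RatFunc.algebraMap_C]
    linear_combination algebraMap ℂ[X] (RatFunc ℂ) D ^ 4 * h
  -- Multiplying by g gives a square root of a polynomial, hence a polynomial U. Then g divides U²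
  -- and, being squarefree, U itself.
  have hU : (algebraMap ℂ[X] (RatFunc ℂ) g * (S * algebraMap ℂ[X] (RatFunc ℂ) D ^ 2)) ^ 2 =
      algebraMap ℂ[X] (RatFunc ℂ) (g * (D * weierstrassForm g₂ g₃ N D)) := by
    rw [map_mul, ← hV]; ring
  obtain ⟨U, hU'⟩ := IsIntegrallyClosed.exists_algebraMap_eq_of_isIntegral_pow
    (R := ℂ[X]) (x := algebraMap ℂ[X] (RatFunc ℂ) g * (S * algebraMap ℂ[X] (RatFunc ℂ) D ^ 2))
    (n := 2) (by norm_num) (hU ▸ isIntegral_algebraMap)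
  rw [← hU', ← map_pow] at hU
  have hdvd : g ∣ U := hg.isRadical 2 U ⟨_, IsFractionRing.injective ℂ[X] (RatFunc ℂ) hU⟩
  obtain ⟨T, rfl⟩ := hdvd
  have hT : S * algebraMap ℂ[X] (RatFunc ℂ) D ^ 2 = algebraMap ℂ[X] (RatFunc ℂ) T := by
    refine mul_left_cancel₀ hg' ?_
    rw [← hU', map_mul]
  refine ⟨T, hT, IsFractionRing.injective ℂ[X] (RatFunc ℂ) ?_⟩
  rw [← hV, hT, map_mul, map_pow]

/-- An elliptic curve has no non-constant points over `ℂ(x)`. -/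
theorem exists_eq_C_of_point {g₂ g₃ : ℂ} (hΔ : g₂ ^ 3 - 27 * g₃ ^ 2 ≠ 0) {q w : RatFunc ℂ}
    (h : w ^ 2 = 4 * q ^ 3 - RatFunc.C g₂ * q - RatFunc.C g₃) :
    (∃ a, q = RatFunc.C a) ∧ ∃ b, w = RatFunc.C b := by
  have hq : ∃ a, q = RatFunc.C a := by
    obtain ⟨T, -, hT⟩ := exists_polynomial_of_twisted_point (g := 1) (S := w) squarefree_one
      q.denom_ne_zero (RatFunc.num_div_denom q).symm (by rw [map_one, one_mul, h])
    have h0 := wronsk_eq_zero_of_sq hΔ q.isCoprime_num_denom (by rw [← hT, one_mul])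
    obtain ⟨a, b, ha, hb⟩ := exists_eq_C_of_wronsk_eq_zero q.isCoprime_num_denom h0
    refine ⟨a / b, ?_⟩
    rw [← RatFunc.num_div_denom q, ha, hb, RatFunc.algebraMap_C, RatFunc.algebraMap_C, map_div₀]
  refine ⟨hq, ?_⟩
  obtain ⟨a, rfl⟩ := hq
  obtain ⟨r, hr⟩ := IsAlgClosed.exists_pow_nat_eq (4 * a ^ 3 - g₂ * a - g₃) two_pos
  have h1 : (w - RatFunc.C r) * (w + RatFunc.C r) = 0 := by
    have := congrArg (RatFunc.C (K := ℂ)) hr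
    simp only [map_sub, map_mul, map_pow, map_ofNat] at this
    linear_combination h - this
  rcases mul_eq_zero.1 h1 with h2 | h2
  · exact ⟨r, sub_eq_zero.1 h2⟩
  · exact ⟨-r, by rw [map_neg]; exact eq_neg_of_add_eq_zero_left h2⟩

/-! ### Covers of elliptic curves by y² = g(x), pointed at infinity -/

/-- A presentation `K = ℂ(x)[y]`, `y² = g(x)`, of a field with `g` squarefree of degree `5`. -/
structure QuinticModel (K : Type) [Field K] [Algebra ℂ K] where
  φ : RatFunc ℂ →ₐ[ℂ] K
  y : K
  g : ℂ[X]
  sq_y : y ^ 2 = φ (algebraMap ℂ[X] (RatFunc ℂ) g)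
  natDegree_g : g.natDegree = 5
  squarefree_g : Squarefree g
  exists_eq : ∀ z : K, ∃ A B : RatFunc ℂ, z = φ A + φ B * y

namespace QuinticModel

variable {K : Type} [Field K] [Algebra ℂ K] (m : QuinticModel K)

/-- `z` has no pole at the point of `y² = g(x)` at infinity. -/
def IsRegularAtInfty (z : K) : Prop :=
  ∃ A B : RatFunc ℂ, z = m.φ A + m.φ B * m.y ∧ A.intDegree ≤ 0 ∧ (B = 0 ∨ B.intDegree ≤ -3)

theorem g_ne_zero : m.g ≠ 0 := m.squarefree_g.ne_zero

theorem algebraMap_g_ne_zero : algebraMap ℂ[X] (RatFunc ℂ) m.g ≠ 0 :=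
  RatFunc.algebraMap_ne_zero m.g_ne_zero

theorem intDegree_sq_mul_g {B : RatFunc ℂ} (hB : B ≠ 0) :
    (B ^ 2 * algebraMap ℂ[X] (RatFunc ℂ) m.g).intDegree = 2 * B.intDegree + 5 := by
  rw [RatFunc.intDegree_mul (pow_ne_zero 2 hB) m.algebraMap_g_ne_zero, intDegree_sq,
    RatFunc.intDegree_polynomial, m.natDegree_g]
  norm_num

theorem φ_injective : Function.Injective m.φ := m.φ.toRingHom.injective

/-- Otherwise A² = B² g, whose two sides have even and odd degree. The convention that 0 has degree
0 keeps this valid for A = 0. -/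
theorem eq_zero_of_add_eq_zero {A B : RatFunc ℂ} (h : m.φ A + m.φ B * m.y = 0) :
    A = 0 ∧ B = 0 := by
  have hB : B = 0 := by
    by_contra hB
    have h1 : A ^ 2 = B ^ 2 * algebraMap ℂ[X] (RatFunc ℂ) m.g := by
      apply m.φ_injective
      rw [map_mul, map_pow, map_pow, ← m.sq_y]
      linear_combination (m.φ A - m.φ B * m.y) * h
    have h2 := congrArg RatFunc.intDegree h1
    rw [intDegree_sq, m.intDegree_sq_mul_g hB] at h2
    omega
  refine ⟨m.φ_injective ?_, hB⟩
  simpa [hB] using h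

theorem ext_iff {A B A' B' : RatFunc ℂ} :
    m.φ A + m.φ B * m.y = m.φ A' + m.φ B' * m.y ↔ A = A' ∧ B = B' := by
  constructor
  · intro h
    have := m.eq_zero_of_add_eq_zero (A := A - A') (B := B - B')
      (by rw [map_sub, map_sub]; linear_combination h)
    exact ⟨sub_eq_zero.1 this.1, sub_eq_zero.1 this.2⟩
  · rintro ⟨rfl, rfl⟩; rfl

theorem y_ne_zero : m.y ≠ 0 := by
  intro h
  have := (m.eq_zero_of_add_eq_zero (A := 0) (B := 1) (by simp [h])).2
  exact one_ne_zero this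

theorem φ_C (a : ℂ) : m.φ (RatFunc.C a) = algebraMap ℂ K a := by
  rw [← RatFunc.algebraMap_eq_C]; exact m.φ.commutes a

/-- The components of the equation of an elliptic curve at a point `(Z₀ + Z₁ y, W₀ + W₁ y)`. -/
theorem point_components {g₂ g₃ : ℂ} {Z₀ Z₁ W₀ W₁ : RatFunc ℂ}
    (h : (m.φ W₀ + m.φ W₁ * m.y) ^ 2 = 4 * (m.φ Z₀ + m.φ Z₁ * m.y) ^ 3
      - algebraMap ℂ K g₂ * (m.φ Z₀ + m.φ Z₁ * m.y) - algebraMap ℂ K g₃) :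
    W₀ ^ 2 + W₁ ^ 2 * algebraMap ℂ[X] (RatFunc ℂ) m.g =
        4 * (Z₀ ^ 3 + 3 * Z₀ * Z₁ ^ 2 * algebraMap ℂ[X] (RatFunc ℂ) m.g)
          - RatFunc.C g₂ * Z₀ - RatFunc.C g₃ ∧
      2 * W₀ * W₁ = 4 * (3 * Z₀ ^ 2 * Z₁ + Z₁ ^ 3 * algebraMap ℂ[X] (RatFunc ℂ) m.g)
        - RatFunc.C g₂ * Z₁ := by
  rw [← m.ext_iff]
  simp only [map_add, map_sub, map_mul, map_pow, map_ofNat, m.φ_C, ← m.sq_y]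
  linear_combination h

/-- A covering that maps the point at infinity to the infinite point of the elliptic curve
is compatible with the hyperelliptic involution: `Z` is a function of `x`. -/
theorem exists_Z_eq (π : EllipticCover K) (hreg : ¬ m.IsRegularAtInfty π.Z) :
    ∃ R : RatFunc ℂ, π.Z = m.φ R := by
  obtain ⟨Z₀, Z₁, hZ⟩ := m.exists_eq π.Z
  obtain ⟨W₀, W₁, hW⟩ := m.exists_eq π.W
  by_cases hZ₁ : Z₁ = 0
  · exact ⟨Z₀, by simpa [hZ₁] using hZ⟩
  exfalso
  have heq := π.equation
  rw [hZ, hW] at heq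
  obtain ⟨e1, e2⟩ := m.point_components heq
  set u := Z₁ ^ 2 * algebraMap ℂ[X] (RatFunc ℂ) m.g with hu
  -- W = L Z + M is the line through the point and its conjugate under y ↦ -y, so L and M lie in
  -- ℂ(x).
  obtain ⟨L, hL⟩ : ∃ L, W₁ = L * Z₁ := ⟨W₁ / Z₁, (div_mul_cancel₀ _ hZ₁).symm⟩
  obtain ⟨M, hM⟩ : ∃ M, W₀ = M + L * Z₀ := ⟨W₀ - L * Z₀, by ring⟩
  have e1' : (M + L * Z₀) ^ 2 + L ^ 2 * u =
      4 * Z₀ ^ 3 + 12 * Z₀ * u - RatFunc.C π.g₂ * Z₀ - RatFunc.C π.g₃ := by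
    rw [hL, hM] at e1
    rw [hu]
    linear_combination e1
  have e2' : 2 * (M + L * Z₀) * L = 12 * Z₀ ^ 2 + 4 * u - RatFunc.C π.g₂ := by
    refine mul_left_cancel₀ hZ₁ ?_
    rw [hL, hM] at e2
    rw [hu]
    linear_combination e2
  -- The third intersection of that line with the cubic has abscissa q. It is a point over ℂ(x),
  -- hence constant.
  obtain ⟨q, hq⟩ : ∃ q, q = RatFunc.C (1 / 4) * L ^ 2 - 2 * Z₀ := ⟨_, rfl⟩
  have h4 : RatFunc.C (1 / 4 : ℂ) * 4 = 1 := by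
    rw [show (4 : RatFunc ℂ) = RatFunc.C 4 from (map_ofNat RatFunc.C 4).symm, ← map_mul]
    norm_num
  have hq' : L ^ 2 = 4 * q + 8 * Z₀ := by
    rw [hq]; linear_combination (-L ^ 2) * h4
  have hpt : (L * q + M) ^ 2 = 4 * q ^ 3 - RatFunc.C π.g₂ * q - RatFunc.C π.g₃ := by
    linear_combination e1' + (q - Z₀) * e2' + (q ^ 2 - 2 * Z₀ * q + Z₀ ^ 2 - u) * hq'
  obtain ⟨⟨c, hc⟩, d, hd⟩ := exists_eq_C_of_point π.disc_ne_zero hpt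
  have hV : 2 * (Z₀ - q) = RatFunc.C (1 / 4) * L ^ 2 + RatFunc.C (-3 * c) := by
    rw [map_mul, ← hc, map_neg, map_ofNat]
    linear_combination hq
  -- Z and its conjugate are the two remaining roots of the cubic on the line; the square of half
  -- their difference is u, and this expresses u through the slope alone.
  have hdisc : RatFunc.C 4 * u =
      (2 * (Z₀ - q)) ^ 2 + (RatFunc.C (2 * d) * L + RatFunc.C (π.g₂ - 12 * c ^ 2)) := by
    simp only [map_mul, map_sub, map_pow, map_ofNat, ← hc, ← hd]
    linear_combination (-1 : RatFunc ℂ) * e2' + 2 * (Z₀ - q) * hq'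
  have hu0 : (RatFunc.C 4 * u).intDegree = 2 * Z₁.intDegree + 5 := by
    rw [intDegree_C_mul (by norm_num), hu, m.intDegree_sq_mul_g hZ₁]
  rcases le_or_gt L.intDegree 0 with hL0 | hL0
  · have h1 : (RatFunc.C (1 / 4 : ℂ) * L ^ 2).intDegree ≤ 0 := by
      rw [intDegree_C_mul (by norm_num), intDegree_sq]; omega
    have h2 : (2 * (Z₀ - q)).intDegree ≤ 0 := by
      rw [hV]
      exact intDegree_add_le_of_le le_rfl h1 (RatFunc.intDegree_C _).le
    have h3 : (RatFunc.C 4 * u).intDegree ≤ 0 := by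
      rw [hdisc]
      refine intDegree_add_le_of_le le_rfl ?_ (intDegree_add_le_of_le le_rfl
        (intDegree_C_mul_le le_rfl _ hL0) (RatFunc.intDegree_C _).le)
      rw [intDegree_sq]; omega
    -- Bounded slope: 2 deg Z₁ + 5 ≤ 0 forces deg Z₁ ≤ -3, so Z is regular at infinity.
    refine hreg ⟨Z₀, Z₁, hZ, ?_, Or.inr (by omega)⟩
    have h5 : Z₀ = RatFunc.C (1 / 2) * (2 * (Z₀ - q)) + RatFunc.C c := by
      have : RatFunc.C (1 / 2 : ℂ) * 2 = 1 := by
        rw [show (2 : RatFunc ℂ) = RatFunc.C 2 from (map_ofNat RatFunc.C 2).symm, ← map_mul]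
        norm_num
      rw [← hc]
      linear_combination (-(Z₀ - q)) * this
    rw [h5]
    exact intDegree_add_le_of_le le_rfl (intDegree_C_mul_le le_rfl _ h2)
      (RatFunc.intDegree_C _).le
  -- Unbounded slope: u would have the even degree 4 deg L, but u = Z₁² g has odd degree.
  · have hLne : L ≠ 0 := by rintro rfl; simp at hL0
    have h1 : (RatFunc.C (1 / 4 : ℂ) * L ^ 2).intDegree = 2 * L.intDegree := by
      rw [intDegree_C_mul (by norm_num), intDegree_sq]
    have h2 : (2 * (Z₀ - q)).intDegree = 2 * L.intDegree := by
      rw [hV, intDegree_add_eq_left_of_lt, h1]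
      · exact mul_ne_zero (by simp) (pow_ne_zero 2 hLne)
      · rw [RatFunc.intDegree_C, h1]; omega
    have h3 : (RatFunc.C 4 * u).intDegree = 4 * L.intDegree := by
      have hne : 2 * (Z₀ - q) ≠ 0 := by
        intro h0; rw [h0, RatFunc.intDegree_zero] at h2; omega
      have h4 : (RatFunc.C (2 * d) * L + RatFunc.C (π.g₂ - 12 * c ^ 2)).intDegree ≤ L.intDegree :=
        intDegree_add_le_of_le hL0.le (intDegree_C_mul_le hL0.le _ le_rfl)
          (by rw [RatFunc.intDegree_C]; exact hL0.le)
      rw [hdisc, intDegree_add_eq_left_of_lt (pow_ne_zero 2 hne)]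
      · rw [intDegree_sq, h2]; ring
      · rw [intDegree_sq, h2]; omega
    omega

theorem finrank_fieldRange : Module.finrank m.φ.fieldRange K = 2 := by
  have hli : LinearIndependent m.φ.fieldRange ![(1 : K), m.y] := by
    rw [LinearIndependent.pair_iff]
    rintro ⟨_, A, rfl⟩ ⟨_, B, rfl⟩ h
    have h' : m.φ A + m.φ B * m.y = 0 := by
      simpa [Algebra.smul_def, IntermediateField.algebraMap_apply] using h
    obtain ⟨rfl, rfl⟩ := m.eq_zero_of_add_eq_zero h'
    constructor <;> ext <;> simp
  have hsp : ⊤ ≤ Submodule.span m.φ.fieldRange (Set.range ![(1 : K), m.y]) := by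
    rintro z -
    obtain ⟨A, B, rfl⟩ := m.exists_eq z
    rw [Matrix.range_cons, Matrix.range_cons, Matrix.range_empty, Set.union_empty,
      Set.singleton_union, Submodule.mem_span_pair]
    refine ⟨⟨m.φ A, A, rfl⟩, ⟨m.φ B, B, rfl⟩, ?_⟩
    simp [Algebra.smul_def, IntermediateField.algebraMap_apply]
  rw [Module.finrank_eq_card_basis (Module.Basis.mk hli hsp), Fintype.card_fin]

-- With Z in ℂ(x), the equation forces W₀ W₁ = 0. If W were in ℂ(x), the base field would lie in
-- ℂ(x), which has index 2 in K, and the degree of the cover would be even.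
open IntermediateField in
theorem exists_W_eq (π : EllipticCover K) (hdeg : Odd π.degree) {R : RatFunc ℂ}
    (hR : π.Z = m.φ R) : ∃ S : RatFunc ℂ, π.W = m.φ S * m.y := by
  obtain ⟨W₀, W₁, hW⟩ := m.exists_eq π.W
  have heq := π.equation
  rw [hR, hW, show m.φ R = m.φ R + m.φ 0 * m.y by simp] at heq
  obtain ⟨-, e2⟩ := m.point_components heq
  have h0 : W₀ * W₁ = 0 := by
    have : (2 : RatFunc ℂ) * (W₀ * W₁) = 0 := by linear_combination e2
    exact (mul_eq_zero.1 this).resolve_left two_ne_zero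
  rcases mul_eq_zero.1 h0 with h | h
  · exact ⟨W₁, by rw [hW, h]; simp⟩
  · exfalso
    have hle : π.baseField ≤ m.φ.fieldRange := by
      rw [EllipticCover.baseField, adjoin_le_iff]
      rintro z (rfl | rfl)
      · exact ⟨R, hR.symm⟩
      · exact ⟨W₀, by rw [hW, h]; simp⟩
    have := relfinrank_mul_finrank_top hle
    rw [m.finrank_fieldRange] at this
    rw [EllipticCover.degree, ← this] at hdeg
    exact (Nat.not_odd_iff_even.2 (even_two.mul_left _)) hdeg

-- The degree of K over ℂ(Z) is computed through ℂ(𝓔) and through ℂ(x): 3r = 2 deg R with r ≤ 2 and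
-- deg R ≠ 0.
open IntermediateField in
theorem max_natDegree_eq (π : EllipticCover K) (hdeg : π.degree = 3) {R : RatFunc ℂ}
    (hR : π.Z = m.φ R) : max R.num.natDegree R.denom.natDegree = 3 := by
  have hle : ℂ⟮π.Z⟯ ≤ π.baseField :=
    adjoin.mono _ _ _ (by simp)
  have hle2 : ℂ⟮π.Z⟯ ≤ m.φ.fieldRange := by
    rw [adjoin_simple_le_iff]; exact ⟨R, hR.symm⟩
  have h1 := relfinrank_mul_finrank_top hle
  have h2 := relfinrank_mul_finrank_top hle2
  rw [m.finrank_fieldRange] at h2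
  have hmap : ℂ⟮π.Z⟯ = (ℂ⟮R⟯).map m.φ := by rw [adjoin_map]; simp [hR]
  have h3 : relfinrank ℂ⟮π.Z⟯ m.φ.fieldRange = max R.num.natDegree R.denom.natDegree := by
    rw [hmap, AlgHom.fieldRange_eq_map, relfinrank_map_map, relfinrank_top_right,
      RatFunc.finrank_eq_max_natDegree]
  have h4 : relfinrank ℂ⟮π.Z⟯ π.baseField ≤ 2 := by
    rw [relfinrank_eq_finrank_of_le hle]
    have he : extendScalars hle = ℂ⟮π.Z⟯⟮π.W⟯ := by
      apply restrictScalars_injective ℂ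
      rw [extendScalars_restrictScalars, EllipticCover.baseField, adjoin_simple_adjoin_simple]
    rw [he]
    set z := AdjoinSimple.gen ℂ π.Z with hz
    set p : ℂ⟮π.Z⟯[X] := X ^ 2 - C (4 * z ^ 3 - algebraMap ℂ _ π.g₂ * z - algebraMap ℂ _ π.g₃)
      with hp
    have hpm : p.Monic := monic_X_pow_sub_C _ two_ne_zero
    have hpW : aeval π.W p = 0 := by
      have h6 : algebraMap ℂ⟮π.Z⟯ K z = π.Z := AdjoinSimple.algebraMap_gen ℂ π.Z
      have h7 : ∀ c : ℂ, algebraMap ℂ⟮π.Z⟯ K (algebraMap ℂ _ c) = algebraMap ℂ K c := fun c => rfl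
      rw [hp, map_sub, map_pow, aeval_X, aeval_C, π.equation]
      simp only [map_sub, map_mul, map_pow, map_ofNat, h6, h7, sub_self]
    rw [adjoin.finrank ⟨p, hpm, hpW⟩]
    refine (natDegree_le_of_dvd (minpoly.dvd _ _ hpW) hpm.ne_zero).trans ?_
    rw [hp, natDegree_X_pow_sub_C]
  have h5 : max R.num.natDegree R.denom.natDegree ≠ 0 := by
    intro h0
    obtain ⟨a, ha⟩ := natDegree_eq_zero.1 (Nat.le_zero.1 (h0 ▸ le_max_left _ _))
    obtain ⟨b, hb⟩ := natDegree_eq_zero.1 (Nat.le_zero.1 (h0 ▸ le_max_right _ _))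
    refine π.nonconstant (a / b) ?_
    rw [hR, ← RatFunc.num_div_denom R, ← ha, ← hb, RatFunc.algebraMap_C, RatFunc.algebraMap_C,
      ← map_div₀, m.φ_C]
  have hd : Module.finrank π.baseField K = 3 := hdeg
  rw [hd] at h1
  rw [h3] at h2
  omega

end QuinticModel

/-! ### The branch polynomial in the centred coordinate -/

theorem eval_weierstrassForm (g₂ g₃ : ℂ) (N D : ℂ[X]) (t : ℂ) :
    (weierstrassForm g₂ g₃ N D).eval t =
      4 * N.eval t ^ 3 - g₂ * N.eval t * D.eval t ^ 2 - g₃ * D.eval t ^ 3 := by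
  simp [weierstrassForm]

/-- The branch points of a tangential cover, in the centred coordinate: besides `±s` they are the
roots of a translate of the Chebyshev polynomial `4 X³ - 3 s² X`. -/
theorem branch_poly_of_centred {g₂ g₃ n₂ n₀ k σ κ : ℂ} {g T N D : ℂ[X]}
    (hg : Squarefree g) (hg5 : g.natDegree = 5) (hk : k ≠ 0) (hκ : κ ≠ 0)
    (hN : N = X ^ 3 + C n₂ * X ^ 2 + C n₀) (hD : D = C k * (X ^ 2 - C σ))
    (hND : IsCoprime N D) (hT : g * T ^ 2 = D * weierstrassForm g₂ g₃ N D)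
    (hw : wronsk N D = T * (C κ * X)) :
    ∃ s γ c : ℂ, s ≠ 0 ∧
      g = C γ * (X ^ 2 - C (s ^ 2)) * (X ^ 3 - C (3 / 4 * s ^ 2) * X + C c) := by
  obtain ⟨s, rfl⟩ := IsAlgClosed.exists_pow_nat_eq σ two_pos
  set e : ℂ := n₀ + n₂ * s ^ 2 with he
  set P : ℂ[X] := X ^ 3 - C (3 * s ^ 2) * X - C (2 * e) with hP
  -- e is chosen so that N takes the value t³ + e at the roots t = ±s of D.
  have hwP : wronsk N D = C k * P * X := by
    rw [wronsk, hN, hD, hP, he]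
    simp only [derivative_add, derivative_sub, derivative_mul, derivative_C, derivative_X_pow]
    simp only [map_mul, map_add, map_pow, map_natCast, map_ofNat]
    push_cast
    ring
  have hTP : C κ * T = C k * P := by
    refine mul_right_cancel₀ (X_ne_zero (R := ℂ)) ?_
    rw [← hwP, hw]; ring
  have hmain : C k * (g * P ^ 2) = C (κ ^ 2) * ((X ^ 2 - C (s ^ 2)) * weierstrassForm g₂ g₃ N D) := by
    refine mul_left_cancel₀ (C_ne_zero.2 hk) ?_
    calc C k * (C k * (g * P ^ 2)) = g * (C k * P) ^ 2 := by ring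
      _ = C (κ ^ 2) * (g * T ^ 2) := by rw [← hTP, map_pow]; ring
      _ = _ := by rw [hT, hD]; ring
  have hNe : ∀ t : ℂ, t ^ 2 = s ^ 2 → t ^ 3 + e ≠ 0 := by
    intro t ht h0
    obtain ⟨u, v, huv⟩ := hND
    have := congrArg (eval t) huv
    simp only [hN, hD, eval_add, eval_mul, eval_sub, eval_pow, eval_X, eval_C, eval_one, ht,
      sub_self, mul_zero, add_zero] at this
    rw [show t ^ 3 + n₂ * s ^ 2 + n₀ = t ^ 3 + e by rw [he]; ring, h0, mul_zero] at this
    exact zero_ne_one this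
  have hPe : ∀ t : ℂ, t ^ 2 = s ^ 2 → P.eval t = -2 * (t ^ 3 + e) := by
    intro t ht
    simp only [hP, eval_sub, eval_pow, eval_mul, eval_X, eval_C, ← ht]
    ring
  have hPne : ∀ t : ℂ, t ^ 2 = s ^ 2 → P.eval t ≠ 0 := by
    intro t ht
    rw [hPe t ht]
    exact mul_ne_zero (by norm_num) (hNe t ht)
  have hge : ∀ t : ℂ, t ^ 2 = s ^ 2 → g.eval t = 0 := by
    intro t ht
    have := congrArg (eval t) hmain
    simp only [eval_mul, eval_C, eval_pow, eval_sub, eval_X, ht, sub_self, zero_mul,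
      mul_zero] at this
    rcases mul_eq_zero.1 ((mul_eq_zero.1 this).resolve_left hk) with h | h
    · exact h
    · exact absurd (pow_eq_zero_iff two_ne_zero |>.1 h) (hPne t ht)
  -- For s = 0 the same evaluation, applied twice, would give X² ∣ g.
  have hs : s ≠ 0 := by
    rintro rfl
    obtain ⟨g', rfl⟩ := (dvd_iff_isRoot.2 (hge 0 rfl) : X - C 0 ∣ g)
    rw [C_0, sub_zero] at *
    have h1 : C k * (g' * P ^ 2) = C (κ ^ 2) * (X * weierstrassForm g₂ g₃ N D) := by
      refine mul_left_cancel₀ (X_ne_zero (R := ℂ)) ?_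
      rw [zero_pow two_ne_zero, C_0, sub_zero] at hmain
      linear_combination hmain
    have h2 := congrArg (eval 0) h1
    simp only [eval_mul, eval_C, eval_pow, eval_X, zero_mul, mul_zero] at h2
    have h3 : g'.eval 0 = 0 := by
      rcases mul_eq_zero.1 ((mul_eq_zero.1 h2).resolve_left hk) with h | h
      · exact h
      · exact absurd (pow_eq_zero_iff two_ne_zero |>.1 h) (hPne 0 rfl)
    obtain ⟨g'', rfl⟩ := (dvd_iff_isRoot.2 h3 : X - C 0 ∣ g')
    rw [C_0, sub_zero] at hg
    exact not_isUnit_X (hg X ⟨g'', by ring⟩)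
  obtain ⟨g', hg'⟩ : X ^ 2 - C (s ^ 2) ∣ g := by
    have h1 : X - C s ∣ g := dvd_iff_isRoot.2 (hge s rfl)
    have h2 : X - C (-s) ∣ g := dvd_iff_isRoot.2 (hge (-s) (by ring))
    have h3 : IsCoprime (X - C s) (X - C (-s)) := by
      refine isCoprime_X_sub_C_of_isUnit_sub (isUnit_iff_ne_zero.2 ?_)
      rw [sub_neg_eq_add, ← two_mul]
      exact mul_ne_zero two_ne_zero hs
    convert h3.mul_dvd h1 h2 using 1
    simp only [map_neg, map_pow]
    ring
  have hq0 : (X ^ 2 - C (s ^ 2) : ℂ[X]) ≠ 0 := (monic_X_pow_sub_C _ two_ne_zero).ne_zero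
  have hg0 : g' ≠ 0 := by rintro rfl; simp [hg'] at hg5
  have hdeg : g'.natDegree = 3 := by
    rw [hg', natDegree_mul hq0 hg0, natDegree_X_pow_sub_C] at hg5
    omega
  have hF : C k * (g' * P ^ 2) = C (κ ^ 2) * weierstrassForm g₂ g₃ N D := by
    refine mul_left_cancel₀ hq0 ?_
    rw [hg'] at hmain
    linear_combination hmain
  obtain ⟨c₃, c₂, c₁, c₀, hc⟩ : ∃ c₃ c₂ c₁ c₀ : ℂ,
      g' = C c₃ * X ^ 3 + C c₂ * X ^ 2 + C c₁ * X + C c₀ := by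
    refine ⟨g'.coeff 3, g'.coeff 2, g'.coeff 1, g'.coeff 0, ?_⟩
    conv_lhs => rw [g'.as_sum_range_C_mul_X_pow' (n := 4) (by omega)]
    simp [Finset.sum_range_succ]
    ring
  have htop : k * c₃ = 4 * κ ^ 2 ∧ k * c₂ = 12 * κ ^ 2 * n₂ := by
    -- Comparison of the coefficients of X⁹ and X⁸ in `hF`; L collects everything of degree at most
    -- 7.
    set Q : ℂ[X] := -(C (3 * s ^ 2) * X) - C (2 * e) with hQ
    set L : ℂ[X] := C (κ ^ 2) * (12 * C n₀ * X ^ 6 + 12 * X ^ 3 * (C n₂ * X ^ 2 + C n₀) ^ 2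
        + 4 * (C n₂ * X ^ 2 + C n₀) ^ 3
        - C g₂ * (X ^ 3 + C n₂ * X ^ 2 + C n₀) * (C k * (X ^ 2 - C (s ^ 2))) ^ 2
        - C g₃ * (C k * (X ^ 2 - C (s ^ 2))) ^ 3)
      - C k * ((C c₃ * X ^ 3 + C c₂ * X ^ 2) * (2 * X ^ 3 * Q + Q ^ 2)
        + (C c₁ * X + C c₀) * (X ^ 3 + Q) ^ 2) with hL
    have hLd : L.natDegree ≤ 7 := by
      rw [hL, hQ]
      compute_degree
    have hid : C (k * c₃ - 4 * κ ^ 2) * X ^ 9 + C (k * c₂ - 12 * κ ^ 2 * n₂) * X ^ 8 = L := by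
      have hPQ : P = X ^ 3 + Q := by rw [hP, hQ]; ring
      rw [hPQ, hc, weierstrassForm, hN, hD] at hF
      rw [hL]
      simp only [map_sub, map_mul, map_pow, map_ofNat] at hF ⊢
      linear_combination hF
    have h9 := congrArg (fun p => coeff p 9) hid
    have h8 := congrArg (fun p => coeff p 8) hid
    simp only [coeff_add, coeff_C_mul, coeff_X_pow,
      coeff_eq_zero_of_natDegree_lt (hLd.trans_lt (by norm_num : 7 < 9)),
      coeff_eq_zero_of_natDegree_lt (hLd.trans_lt (by norm_num : 7 < 8))] at h9 h8
    norm_num at h9 h8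
    exact ⟨sub_eq_zero.1 h9, sub_eq_zero.1 h8⟩
  have hNev : ∀ t : ℂ, t ^ 2 = s ^ 2 → N.eval t = t ^ 3 + e := by
    intro t ht
    simp only [hN, he, eval_add, eval_mul, eval_pow, eval_X, eval_C, ht]
    ring
  have hDev : ∀ t : ℂ, t ^ 2 = s ^ 2 → D.eval t = 0 := by
    intro t ht
    simp only [hD, eval_sub, eval_mul, eval_pow, eval_X, eval_C, ht, sub_self, mul_zero]
  -- At a root of D the form F reduces to 4N³, while P = -2N there, so N² cancels.
  have hev : ∀ t : ℂ, t ^ 2 = s ^ 2 → k * g'.eval t = κ ^ 2 * (t ^ 3 + e) := by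
    intro t ht
    have := congrArg (eval t) hF
    rw [eval_mul, eval_mul, eval_mul, eval_pow, eval_C, eval_C, eval_weierstrassForm,
      hPe t ht, hNev t ht, hDev t ht] at this
    refine mul_left_cancel₀ (pow_ne_zero 2 (hNe t ht)) ?_
    linear_combination (1 / 4) * this
  -- P' = 3(X² - s²) vanishes at s, so differentiating `hF` involves only the derivative of g'.
  have hder : k * (derivative g').eval s = κ ^ 2 * 3 * (3 * s ^ 2 + 2 * n₂ * s) := by
    have := congrArg (fun p => eval s (derivative p)) hF
    have hP' : (derivative P).eval s = 0 := by
      simp only [hP, derivative_sub, derivative_mul, derivative_C, derivative_X_pow, derivative_X,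
        eval_sub, eval_add, eval_mul, eval_pow, eval_X, eval_C, eval_one, eval_zero, map_natCast,
        eval_natCast]
      push_cast
      ring
    have hN' : (derivative N).eval s = 3 * s ^ 2 + 2 * n₂ * s := by
      simp [hN]
      ring
    simp only [derivative_mul, derivative_C, zero_mul, zero_add, derivative_pow, eval_mul,
      eval_add, eval_C, hP', mul_zero, add_zero, derivative_weierstrassForm, eval_sub, eval_pow,
      eval_ofNat, hPe s rfl, hNev s rfl, hDev s rfl, hN'] at this
    refine mul_left_cancel₀ (pow_ne_zero 2 (hNe s rfl)) ?_
    linear_combination (1 / 4) * this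
  have hev1 := hev s rfl
  have hev2 := hev (-s) (by ring)
  simp only [hc, derivative_add, derivative_mul, derivative_C, derivative_X_pow, derivative_X,
    eval_add, eval_mul, eval_pow, eval_X, eval_C, eval_one, eval_zero, map_natCast,
    eval_natCast] at hev1 hev2 hder
  push_cast at hder
  obtain ⟨h3, h2⟩ := htop
  have hκ2 : κ ^ 2 ≠ 0 := pow_ne_zero 2 hκ
  have hc1 : c₁ = -(3 / 4) * s ^ 2 * c₃ := by
    refine mul_left_cancel₀ (mul_ne_zero hk hs) ?_
    linear_combination (1 / 2) * hev1 - (1 / 2) * hev2 - (1 / 4) * s ^ 3 * h3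
  have hn : n₂ = 0 := by
    have : κ ^ 2 * s * n₂ = 0 := by
      rw [hc1] at hder
      linear_combination (1 / 18) * hder - (1 / 8) * s ^ 2 * h3 - (1 / 9) * s * h2
    simpa [hκ2, hs] using this
  have hc2 : c₂ = 0 := by
    rw [hn, mul_zero] at h2
    exact (mul_eq_zero.1 h2).resolve_left hk
  have hc3 : c₃ ≠ 0 := by
    rintro rfl
    rw [mul_zero] at h3
    exact mul_ne_zero (by norm_num) hκ2 h3.symm
  refine ⟨s, c₃, c₀ / c₃, hs, ?_⟩
  rw [hg', hc, hc2, hc1]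
  have : C c₀ = C c₃ * C (c₀ / c₃) := by rw [← C_mul, mul_div_cancel₀ _ hc3]
  rw [this]
  simp only [map_mul, map_neg, map_pow, map_zero]
  ring

/-! ### Normal form of the cover and the trace condition -/

namespace QuinticModel

variable {K : Type} [Field K] [Algebra ℂ K] (m : QuinticModel K)

theorem φ_algebraMap (p : ℂ[X]) :
    m.φ (algebraMap ℂ[X] (RatFunc ℂ) p) = aeval (m.φ RatFunc.X) p := by
  rw [← RatFunc.aeval_X_left_eq_algebraMap, aeval_algHom_apply]

theorem aeval_X_injective : Function.Injective (aeval (R := ℂ) (m.φ RatFunc.X)) := by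
  intro p q h
  rw [← m.φ_algebraMap, ← m.φ_algebraMap] at h
  exact IsFractionRing.injective ℂ[X] (RatFunc ℂ) (m.φ_injective h)

theorem aeval_X_ne_zero {p : ℂ[X]} (hp : p ≠ 0) : aeval (m.φ RatFunc.X) p ≠ 0 := by
  intro h
  exact hp (m.aeval_X_injective (by rw [h, map_zero]))

/-- The shape of a pointed covering of degree `3`. -/
theorem exists_normal_form (π : EllipticCover K) (hdeg : π.degree = 3)
    (hreg : ¬ m.IsRegularAtInfty π.Z) :
    ∃ N D T : ℂ[X], N.Monic ∧ N.natDegree = 3 ∧ D.natDegree ≤ 2 ∧ D ≠ 0 ∧ IsCoprime N D ∧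
      m.g * T ^ 2 = D * weierstrassForm π.g₂ π.g₃ N D ∧
      π.Z * aeval (m.φ RatFunc.X) D = aeval (m.φ RatFunc.X) N ∧
      π.W * aeval (m.φ RatFunc.X) D ^ 2 = aeval (m.φ RatFunc.X) T * m.y := by
  obtain ⟨R, hR⟩ := m.exists_Z_eq π hreg
  obtain ⟨S, hS⟩ := m.exists_W_eq π (by rw [hdeg]; decide) hR
  have hmax := m.max_natDegree_eq π hdeg hR
  have hR0 : 0 < R.intDegree := by
    by_contra hle
    exact hreg ⟨R, 0, by simpa using hR, not_lt.1 hle, Or.inl rfl⟩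
  rw [RatFunc.intDegree] at hR0
  have hn3 : R.num.natDegree = 3 := by omega
  have hd2 : R.denom.natDegree ≤ 2 := by omega
  have hν : R.num.leadingCoeff⁻¹ ≠ 0 := by
    refine inv_ne_zero (leadingCoeff_ne_zero.2 ?_)
    intro h0; simp [h0] at hn3
  set ν := R.num.leadingCoeff⁻¹ with hνdef
  have hD0 : C ν * R.denom ≠ 0 := mul_ne_zero (C_ne_zero.2 hν) R.denom_ne_zero
  have hRND : R = algebraMap ℂ[X] (RatFunc ℂ) (C ν * R.num) /
      algebraMap ℂ[X] (RatFunc ℂ) (C ν * R.denom) := by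
    rw [map_mul, map_mul, mul_div_mul_left _ _ (RatFunc.algebraMap_ne_zero (C_ne_zero.2 hν)),
      RatFunc.num_div_denom]
  have heq : algebraMap ℂ[X] (RatFunc ℂ) m.g * S ^ 2 =
      4 * R ^ 3 - RatFunc.C π.g₂ * R - RatFunc.C π.g₃ := by
    apply m.φ_injective
    simp only [map_sub, map_mul, map_pow, map_ofNat, m.φ_C, ← m.sq_y, ← hR]
    rw [← π.equation, hS]; ring
  obtain ⟨T, hT1, hT2⟩ := exists_polynomial_of_twisted_point m.squarefree_g hD0 hRND heq
  refine ⟨C ν * R.num, C ν * R.denom, T, ?_, ?_, ?_, hD0, ?_, hT2, ?_, ?_⟩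
  · rw [Monic, leadingCoeff_mul, leadingCoeff_C, hνdef,
      inv_mul_cancel₀ (fun h0 => hν (by rw [hνdef, h0, inv_zero]))]
  · rw [natDegree_C_mul hν, hn3]
  · rw [natDegree_C_mul hν]; exact hd2
  · have hu : IsUnit (C ν) := isUnit_C.2 (isUnit_iff_ne_zero.2 hν)
    exact (isCoprime_mul_unit_left hu _ _).2 R.isCoprime_num_denom
  · rw [← m.φ_algebraMap, ← m.φ_algebraMap, hR, ← map_mul]
    congr 1
    exact ((eq_div_iff (RatFunc.algebraMap_ne_zero hD0)).1 hRND)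
  · rw [← m.φ_algebraMap, ← m.φ_algebraMap, ← hT1, hS, map_mul m.φ S, map_pow]
    ring

theorem D_Z {π : EllipticCover K} {N D : ℂ[X]}
    (hZ : π.Z * aeval (m.φ RatFunc.X) D = aeval (m.φ RatFunc.X) N) :
    aeval (m.φ RatFunc.X) D ^ 2 • KaehlerDifferential.D ℂ K π.Z =
      aeval (m.φ RatFunc.X) (wronsk N D) • KaehlerDifferential.D ℂ K (m.φ RatFunc.X) := by
  have h := congrArg (KaehlerDifferential.D ℂ K) hZ
  rw [Derivation.leibniz, Derivation.map_aeval, Derivation.map_aeval] at h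
  have h2 : aeval (m.φ RatFunc.X) D • KaehlerDifferential.D ℂ K π.Z =
      (aeval (m.φ RatFunc.X) (derivative N) - π.Z * aeval (m.φ RatFunc.X) (derivative D)) •
        KaehlerDifferential.D ℂ K (m.φ RatFunc.X) := by
    rw [sub_smul, ← h, mul_smul]; abel
  rw [sq, mul_smul, h2, smul_smul]
  congr 1
  rw [wronsk, map_sub, map_mul, map_mul, ← hZ]
  ring

/-- The quotient of `-dx/y` by the pull-back of the holomorphic differential. -/
theorem quotient_mul_wronsk {π : EllipticCover K} {N D T : ℂ[X]} (hD0 : D ≠ 0)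
    (hZ : π.Z * aeval (m.φ RatFunc.X) D = aeval (m.φ RatFunc.X) N)
    (hW : π.W * aeval (m.φ RatFunc.X) D ^ 2 = aeval (m.φ RatFunc.X) T * m.y)
    (hx : KaehlerDifferential.D ℂ K (m.φ RatFunc.X) ≠ 0) {h : K}
    (hh : (-m.y⁻¹) • KaehlerDifferential.D ℂ K (m.φ RatFunc.X) = h • π.du) :
    h * aeval (m.φ RatFunc.X) (wronsk N D) = -aeval (m.φ RatFunc.X) T := by
  have hDK := m.aeval_X_ne_zero hD0
  have hy := m.y_ne_zero
  have hW0 : π.W ≠ 0 := by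
    intro h0
    rw [EllipticCover.du, h0, inv_zero, zero_smul, smul_zero, smul_eq_zero] at hh
    rcases hh with hh | hh
    · exact (neg_ne_zero.2 (inv_ne_zero hy)) hh
    · exact hx hh
  have h1 : (-(π.W * aeval (m.φ RatFunc.X) D ^ 2) * m.y⁻¹) •
      KaehlerDifferential.D ℂ K (m.φ RatFunc.X) =
      (h * aeval (m.φ RatFunc.X) (wronsk N D)) • KaehlerDifferential.D ℂ K (m.φ RatFunc.X) := by
    rw [mul_smul h, ← m.D_Z hZ]
    have := congrArg (fun ω => (π.W * aeval (m.φ RatFunc.X) D ^ 2) • ω) hh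
    simp only [EllipticCover.du, smul_smul] at this ⊢
    rw [neg_mul, ← mul_neg, this]
    congr 1
    field_simp
  have h2 := smul_left_injective K hx h1
  rw [← h2, hW]
  field_simp

-- The field contains x, hence ℂ(x), and y = W D²/T. So a monic cubic killing 1/(x - ρ) is its
-- minimal polynomial.
open IntermediateField in
theorem adjoin_inv_X_sub_eq_top {π : EllipticCover K} {D T : ℂ[X]}
    (hT0 : T ≠ 0) (hW : π.W * aeval (m.φ RatFunc.X) D ^ 2 = aeval (m.φ RatFunc.X) T * m.y)
    (ρ : ℂ) : π.baseField⟮(m.φ RatFunc.X - algebraMap ℂ K ρ)⁻¹⟯ = ⊤ := by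
  set E := π.baseField⟮(m.φ RatFunc.X - algebraMap ℂ K ρ)⁻¹⟯ with hE
  have hbase : ∀ z ∈ π.baseField, z ∈ E := fun z hz => E.algebraMap_mem ⟨z, hz⟩
  have hC : ∀ a : ℂ, algebraMap ℂ K a ∈ E := fun a => hbase _ (π.baseField.algebraMap_mem a)
  have hX : m.φ RatFunc.X ∈ E := by
    have h1 := E.inv_mem (mem_adjoin_simple_self π.baseField
      (m.φ RatFunc.X - algebraMap ℂ K ρ)⁻¹)
    rw [inv_inv] at h1
    simpa using E.add_mem h1 (hC ρ)
  have hφ : ∀ A, m.φ A ∈ E := by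
    intro A
    have hle : ℂ⟮m.φ RatFunc.X⟯ ≤ E.restrictScalars ℂ := by
      rw [adjoin_simple_le_iff]; exact hX
    apply hle
    have hmap : ℂ⟮m.φ RatFunc.X⟯ = (ℂ⟮(RatFunc.X : RatFunc ℂ)⟯).map m.φ := by
      rw [adjoin_map]; simp
    rw [hmap, RatFunc.adjoin_X]
    exact ⟨A, trivial, rfl⟩
  have hy : m.y ∈ E := by
    have h1 : m.y = π.W * aeval (m.φ RatFunc.X) D ^ 2 / aeval (m.φ RatFunc.X) T := by
      rw [hW, mul_div_cancel_left₀ _ (m.aeval_X_ne_zero hT0)]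
    rw [h1, ← m.φ_algebraMap, ← m.φ_algebraMap]
    exact E.div_mem (E.mul_mem (hbase _ (subset_adjoin _ _ (by simp))) (pow_mem (hφ _) 2)) (hφ _)
  rw [eq_top_iff]
  rintro z -
  obtain ⟨A, B, rfl⟩ := m.exists_eq z
  exact E.add_mem (hφ A) (E.mul_mem (hφ B) hy)

theorem eq_zero_of_sub_Z_mul {π : EllipticCover K} {a b : ℂ}
    (h : algebraMap ℂ K a - π.Z * algebraMap ℂ K b = 0) : a = 0 ∧ b = 0 := by
  have hb : b = 0 := by
    by_contra hb
    refine π.nonconstant (a / b) ?_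
    rw [map_div₀, eq_div_iff ((_root_.map_ne_zero _).2 hb)]
    exact (sub_eq_zero.1 h).symm
  refine ⟨?_, hb⟩
  simpa [hb] using h

open IntermediateField in
/-- If the trace of `1/(x - ρ)` vanishes, then `ρ` is a common critical point of `N` and `D`. -/
theorem linear_coeff_eq_zero {π : EllipticCover K} (hdeg : π.degree = 3)
    {D N T : ℂ[X]} (hND : IsCoprime N D)
    (hT0 : T ≠ 0) (hZ : π.Z * aeval (m.φ RatFunc.X) D = aeval (m.φ RatFunc.X) N)
    (hW : π.W * aeval (m.φ RatFunc.X) D ^ 2 = aeval (m.φ RatFunc.X) T * m.y)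
    {ρ n₂ n₁ n₀ d₂ d₁ d₀ : ℂ}
    (hN : N = (X - C ρ) ^ 3 + C n₂ * (X - C ρ) ^ 2 + C n₁ * (X - C ρ) + C n₀)
    (hD : D = C d₂ * (X - C ρ) ^ 2 + C d₁ * (X - C ρ) + C d₀)
    (htr : Algebra.trace π.baseField K (m.φ RatFunc.X - algebraMap ℂ K ρ)⁻¹ = 0) :
    n₁ = 0 ∧ d₁ = 0 := by
  set ξ := m.φ RatFunc.X - algebraMap ℂ K ρ with hξ
  have hξ0 : ξ ≠ 0 := by
    have := m.aeval_X_ne_zero (X_sub_C_ne_zero ρ)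
    simpa [hξ] using this
  set B := π.baseField with hB
  set z : B := ⟨π.Z, subset_adjoin _ _ (by simp)⟩ with hz
  have hzK : algebraMap B K z = π.Z := rfl
  have hCK : ∀ c : ℂ, algebraMap B K (algebraMap ℂ B c) = algebraMap ℂ K c := fun c => rfl
  have hrank : Module.finrank B K = 3 := hdeg
  have hfd : FiniteDimensional B K := Module.finite_of_finrank_pos (by rw [hrank]; norm_num)
  set e : ℂ → ℂ → B := fun a b => algebraMap ℂ B a - z * algebraMap ℂ B b with he
  have heK : ∀ a b, algebraMap B K (e a b) = algebraMap ℂ K a - π.Z * algebraMap ℂ K b := by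
    intro a b
    rw [he, map_sub, map_mul, hzK, hCK, hCK]
  have he0 : ∀ a b, e a b = 0 → a = 0 ∧ b = 0 := by
    intro a b h0
    refine eq_zero_of_sub_Z_mul (π := π) ?_
    rw [← heK, h0, map_zero]
  have hconst : e n₀ d₀ ≠ 0 := by
    intro h0
    obtain ⟨hn, hd⟩ := he0 _ _ h0
    obtain ⟨u, v, huv⟩ := hND
    have := congrArg (eval ρ) huv
    simp [hN, hD, hn, hd] at this
  -- N(x) - Z D(x) = 0, expanded in ξ = x - ρ and reversed, is a cubic for 1/ξ. Its X² coefficient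
  -- is minus the trace.
  set p : B[X] := X ^ 3 + C (e n₁ d₁ / e n₀ d₀) * X ^ 2 + C (e n₂ d₂ / e n₀ d₀) * X
    + C (1 / e n₀ d₀) with hp
  have hpd : p.natDegree = 3 := by rw [hp]; compute_degree!
  have hpm : p.Monic := by rw [hp]; monicity!
  have hpξ : aeval ξ⁻¹ p = 0 := by
    have h1 : ξ ^ 3 + algebraMap ℂ K n₂ * ξ ^ 2 + algebraMap ℂ K n₁ * ξ + algebraMap ℂ K n₀ =
        π.Z * (algebraMap ℂ K d₂ * ξ ^ 2 + algebraMap ℂ K d₁ * ξ + algebraMap ℂ K d₀) := by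
      rw [hN, hD] at hZ
      simpa [hξ] using hZ.symm
    have hc0 : algebraMap ℂ K n₀ - π.Z * algebraMap ℂ K d₀ ≠ 0 := by
      rw [← heK]; exact (_root_.map_ne_zero _).2 hconst
    simp only [hp, map_add, map_mul, map_pow, aeval_X, aeval_C, map_div₀, heK, map_one]
    field_simp
    linear_combination h1
  have hint : IsIntegral B ξ⁻¹ := ⟨p, hpm, hpξ⟩
  have htop : B⟮ξ⁻¹⟯ = ⊤ := m.adjoin_inv_X_sub_eq_top hT0 hW ρ
  have hmd : (minpoly B ξ⁻¹).natDegree = 3 := by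
    rw [← adjoin.finrank hint, htop, finrank_top', hrank]
  have hmin : p = minpoly B ξ⁻¹ :=
    eq_of_monic_of_dvd_of_natDegree_le (minpoly.monic hint) hpm (minpoly.dvd _ _ hpξ)
      (by rw [hmd, hpd])
  rw [trace_eq_finrank_mul_minpoly_nextCoeff, ← hmin, htop, IntermediateField.finrank_top,
    nextCoeff_of_natDegree_pos (by rw [hpd]; norm_num), hpd] at htr
  have hcoeff : p.coeff 2 = e n₁ d₁ / e n₀ d₀ := by
    simp [hp]
  have h3 : e n₁ d₁ / e n₀ d₀ = 0 := by
    simpa [hcoeff] using htr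
  exact he0 _ _ ((div_eq_zero_iff.1 h3).resolve_right hconst)

end QuinticModel

/-! ### Recentring, and the equation of the curve -/

theorem comp_X_add_C_comp (p : ℂ[X]) (ρ : ℂ) : (p.comp (X + C ρ)).comp (X - C ρ) = p := by
  rw [comp_assoc]; simp

theorem exists_expansion {P : ℂ[X]} (hP : P.natDegree ≤ 3) (ρ : ℂ) :
    ∃ p₂ p₁ p₀ : ℂ, P = C (P.coeff 3) * (X - C ρ) ^ 3 + C p₂ * (X - C ρ) ^ 2
      + C p₁ * (X - C ρ) + C p₀ := by
  have hQ : (P.comp (X + C ρ)).natDegree ≤ 3 := by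
    rw [natDegree_comp, natDegree_X_add_C, mul_one]; exact hP
  set Q := P.comp (X + C ρ) with hQdef
  have h1 : Q = C (Q.coeff 3) * X ^ 3 + C (Q.coeff 2) * X ^ 2 + C (Q.coeff 1) * X
      + C (Q.coeff 0) := by
    conv_lhs => rw [Q.as_sum_range_C_mul_X_pow' (n := 4) (by omega)]
    simp [Finset.sum_range_succ]
    ring
  have h2 : P = C (Q.coeff 3) * (X - C ρ) ^ 3 + C (Q.coeff 2) * (X - C ρ) ^ 2
      + C (Q.coeff 1) * (X - C ρ) + C (Q.coeff 0) := by
    conv_lhs => rw [← comp_X_add_C_comp P ρ, ← hQdef, h1]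
    simp
  refine ⟨Q.coeff 2, Q.coeff 1, Q.coeff 0, ?_⟩
  suffices h3 : P.coeff 3 = Q.coeff 3 by rw [h3]; exact h2
  have h4 : P - C (Q.coeff 3) * X ^ 3 = C (Q.coeff 3) * (-(3 * C ρ * X ^ 2) + 3 * C ρ ^ 2 * X
      - C ρ ^ 3) + C (Q.coeff 2) * (X - C ρ) ^ 2 + C (Q.coeff 1) * (X - C ρ) + C (Q.coeff 0) := by
    conv_lhs => rw [h2]
    ring
  have h5 : (P - C (Q.coeff 3) * X ^ 3).natDegree ≤ 2 := by
    rw [h4]; compute_degree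
  have h6 := coeff_eq_zero_of_natDegree_lt (h5.trans_lt (by norm_num : 2 < 3))
  rw [coeff_sub, coeff_C_mul, coeff_X_pow_self, mul_one] at h6
  exact sub_eq_zero.1 h6

theorem squarefree_comp_X_add_C {p : ℂ[X]} (hp : Squarefree p) (ρ : ℂ) :
    Squarefree (p.comp (X + C ρ)) := by
  intro q hq
  have h1 : q.comp (X - C ρ) * q.comp (X - C ρ) ∣ p := by
    obtain ⟨r, hr⟩ := hq
    refine ⟨r.comp (X - C ρ), ?_⟩
    rw [← mul_comp, ← mul_comp, ← hr, comp_X_add_C_comp]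
  have h2 := hp _ h1
  have h3 : (q.comp (X - C ρ)).comp (X + C ρ) = q := by rw [comp_assoc]; simp
  rw [← h3]
  exact h2.map (compRingHom (X + C ρ))

theorem weierstrassForm_comp (g₂ g₃ : ℂ) (N D q : ℂ[X]) :
    (weierstrassForm g₂ g₃ N D).comp q = weierstrassForm g₂ g₃ (N.comp q) (D.comp q) := by
  simp [weierstrassForm]

theorem wronsk_comp_X_add_C (N D : ℂ[X]) (ρ : ℂ) :
    (wronsk N D).comp (X + C ρ) = wronsk (N.comp (X + C ρ)) (D.comp (X + C ρ)) := by
  simp [wronsk, derivative_comp]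

namespace QuinticModel

variable {K : Type} [Field K] [Algebra ℂ K] (m : QuinticModel K)

/-- The equation of the curve underlying a tangential cover of degree `3`. -/
theorem exists_branch_form (π : EllipticCover K) (hdeg : π.degree = 3)
    (hreg : ¬ m.IsRegularAtInfty π.Z)
    (hx : KaehlerDifferential.D ℂ K (m.φ RatFunc.X) ≠ 0) {h : K}
    (hh : (-m.y⁻¹) • KaehlerDifferential.D ℂ K (m.φ RatFunc.X) = h • π.du)
    (htr : Algebra.trace π.baseField K h = 0) :
    ∃ ρ s γ c : ℂ, s ≠ 0 ∧ m.g = C γ * ((X - C ρ) ^ 2 - C (s ^ 2)) *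
      ((X - C ρ) ^ 3 - C (3 / 4 * s ^ 2) * (X - C ρ) + C c) := by
  obtain ⟨N, D, T, hNm, hN3, hD2, hD0, hND, hT, hZ, hW⟩ := m.exists_normal_form π hdeg hreg
  have hF9 := natDegree_weierstrassForm_of_lt π.g₂ π.g₃ (N := N) (D := D) (by omega)
  have hF0 : weierstrassForm π.g₂ π.g₃ N D ≠ 0 := by
    intro h0; rw [h0, natDegree_zero] at hF9; omega
  have hT0 : T ≠ 0 := by
    rintro rfl
    rw [zero_pow two_ne_zero, mul_zero] at hT
    exact mul_ne_zero hD0 hF0 hT.symm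
  -- By parity deg D is 0 or 2, so deg T is 2 or 3; the Wronskian bound then gives deg l = 0 or deg
  -- l ≤ 1 respectively.
  have hdegs : 5 + 2 * T.natDegree = D.natDegree + 9 := by
    have := congrArg natDegree hT
    rwa [natDegree_mul m.g_ne_zero (pow_ne_zero 2 hT0), natDegree_mul hD0 hF0, natDegree_pow,
      hF9, hN3, m.natDegree_g] at this
  obtain ⟨l, hl⟩ := dvd_wronsk π.disc_ne_zero hND hT
  have hTK := m.aeval_X_ne_zero hT0
  have hhl : h * aeval (m.φ RatFunc.X) l = -1 := by
    have h1 := m.quotient_mul_wronsk hD0 hZ hW hx hh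
    rw [hl, map_mul] at h1
    refine mul_left_cancel₀ hTK ?_
    linear_combination h1
  have hl0 : l ≠ 0 := by rintro rfl; simp at hhl
  have hw0 : wronsk N D ≠ 0 := by rw [hl]; exact mul_ne_zero hT0 hl0
  have hwlt := natDegree_wronsk_lt hw0
  rw [hl, natDegree_mul hT0 hl0, hN3] at hwlt
  have hrank : Module.finrank π.baseField K = 3 := hdeg
  -- For constant l, h is a nonzero constant, and its trace is 3h.
  have hl1 : l.natDegree ≠ 0 := by
    intro h0
    obtain ⟨a, rfl⟩ := natDegree_eq_zero.1 h0
    rw [aeval_C] at hhl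
    have ha : a ≠ 0 := by rintro rfl; simp at hl0
    have h1 : h = algebraMap π.baseField K (algebraMap ℂ π.baseField (-a⁻¹)) := by
      change h = algebraMap ℂ K (-a⁻¹)
      rw [map_neg, map_inv₀]
      have : algebraMap ℂ K a ≠ 0 := (_root_.map_ne_zero _).2 ha
      field_simp
      exact hhl
    rw [h1, Algebra.trace_algebraMap, hrank, smul_eq_zero] at htr
    rcases htr with h2 | h2
    · norm_num at h2
    · rw [_root_.map_eq_zero] at h2
      exact neg_ne_zero.2 (inv_ne_zero ha) h2
  have hD2' : D.natDegree = 2 := by omega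
  have hl1' : l.natDegree = 1 := by omega
  obtain ⟨κ, ρ, hκ, rfl⟩ : ∃ κ ρ : ℂ, κ ≠ 0 ∧ l = C κ * (X - C ρ) := by
    obtain ⟨κ, hκ, b, hb⟩ := natDegree_eq_one.1 hl1'
    refine ⟨κ, -b / κ, hκ, ?_⟩
    rw [← hb, mul_sub, ← C_mul, mul_div_cancel₀ _ hκ, map_neg, sub_neg_eq_add]
  obtain ⟨n₂, n₁, n₀, hN⟩ := exists_expansion hN3.le ρ
  obtain ⟨d₂, d₁, d₀, hD⟩ := exists_expansion (hD2.trans (by norm_num)) ρ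
  have hNc : N.coeff 3 = 1 := by rw [← hN3]; exact hNm
  have hDc : D.coeff 3 = 0 := coeff_eq_zero_of_natDegree_lt (by omega)
  rw [hNc, C_1, one_mul] at hN
  rw [hDc, C_0, zero_mul, zero_add] at hD
  have htr' : Algebra.trace π.baseField K (m.φ RatFunc.X - algebraMap ℂ K ρ)⁻¹ = 0 := by
    have hξ : m.φ RatFunc.X - algebraMap ℂ K ρ ≠ 0 := by
      simpa using m.aeval_X_ne_zero (X_sub_C_ne_zero ρ)
    have h1 : (m.φ RatFunc.X - algebraMap ℂ K ρ)⁻¹ = (algebraMap ℂ π.baseField (-κ)) • h := by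
      rw [Algebra.smul_def]
      change _ = algebraMap ℂ K (-κ) * h
      simp only [map_mul, map_sub, aeval_C, aeval_X] at hhl
      rw [map_neg]
      field_simp
      linear_combination hhl
    rw [h1, map_smul, htr, smul_zero]
  obtain ⟨rfl, rfl⟩ := m.linear_coeff_eq_zero hdeg hND hT0 hZ hW hN hD htr'
  have hd₂ : d₂ ≠ 0 := by
    rintro rfl
    rw [hD] at hD2'
    simp at hD2'
  have hgc := branch_poly_of_centred (g₂ := π.g₂) (g₃ := π.g₃) (n₂ := n₂) (n₀ := n₀) (k := d₂)
    (σ := -d₀ / d₂) (κ := κ) (g := m.g.comp (X + C ρ)) (T := T.comp (X + C ρ))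
    (N := N.comp (X + C ρ)) (D := D.comp (X + C ρ))
    (squarefree_comp_X_add_C m.squarefree_g ρ)
    (by rw [natDegree_comp, natDegree_X_add_C, m.natDegree_g]) hd₂ hκ
    (by rw [hN]; simp)
    (by
      rw [hD, mul_sub (C d₂) (X ^ 2), ← C_mul, mul_div_cancel₀ _ hd₂]
      simp)
    (hND.map (compRingHom (X + C ρ)))
    (by rw [← weierstrassForm_comp, ← mul_comp, ← hT, mul_comp, pow_comp])
    (by rw [← wronsk_comp_X_add_C, hl]; simp)
  obtain ⟨s, γ, c, hs, hg⟩ := hgc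
  refine ⟨ρ, s, γ, c, hs, ?_⟩
  have := congrArg (fun p => comp p (X - C ρ)) hg
  simp only [comp_X_add_C_comp] at this
  rw [this]
  simp only [mul_comp, add_comp, sub_comp, pow_comp, X_comp, C_comp]

end QuinticModel

/-! ### The coordinate x = 1/λ on Γ -/

theorem aeval_inv_X_injective :
    Function.Injective (aeval (R := ℂ) (RatFunc.X⁻¹ : RatFunc ℂ)) := by
  have h : ¬ ∃ c, (RatFunc.X⁻¹ : RatFunc ℂ) = RatFunc.C c := by
    rintro ⟨c, hc⟩
    have := congrArg RatFunc.intDegree hc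
    rw [RatFunc.intDegree_inv, RatFunc.intDegree_X, RatFunc.intDegree_C] at this
    norm_num at this
  exact transcendental_iff_injective.1 (RatFunc.transcendental_of_ne_C _ h)

/-- The automorphism `x ↦ 1/x` of `ℂ(x)`. -/
noncomputable def invX : RatFunc ℂ →ₐ[ℂ] RatFunc ℂ :=
  RatFunc.liftAlgHom (aeval (RatFunc.X⁻¹ : RatFunc ℂ))
    (nonZeroDivisors_le_comap_nonZeroDivisors_of_injective _ aeval_inv_X_injective)

theorem invX_algebraMap (p : ℂ[X]) :
    invX (algebraMap ℂ[X] (RatFunc ℂ) p) = aeval (RatFunc.X⁻¹ : RatFunc ℂ) p := by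
  have := RatFunc.liftAlgHom_apply_div (aeval (R := ℂ) (RatFunc.X⁻¹ : RatFunc ℂ))
    (nonZeroDivisors_le_comap_nonZeroDivisors_of_injective _ aeval_inv_X_injective) p 1
  rwa [map_one, map_one, div_one, div_one] at this

theorem invX_X : invX RatFunc.X = RatFunc.X⁻¹ := by
  rw [← RatFunc.algebraMap_X, invX_algebraMap, aeval_X, RatFunc.algebraMap_X]

theorem invX_invX (A : RatFunc ℂ) : invX (invX A) = A := by
  have h : ∀ p : ℂ[X], invX (invX (algebraMap ℂ[X] (RatFunc ℂ) p)) = algebraMap _ _ p := by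
    intro p
    rw [invX_algebraMap, ← aeval_algHom_apply, map_inv₀, invX_X, inv_inv,
      RatFunc.aeval_X_left_eq_algebraMap]
  rw [← RatFunc.num_div_denom A, map_div₀, map_div₀, h, h]

/-- A rational function without a pole at infinity, in the coordinate `1/x`. -/
theorem exists_invX_mul_eq {A : RatFunc ℂ} (hA : A.intDegree ≤ 0) :
    ∃ a d : ℂ[X], d.eval 0 ≠ 0 ∧
      invX A * algebraMap ℂ[X] (RatFunc ℂ) d = algebraMap ℂ[X] (RatFunc ℂ) a := by
  rw [RatFunc.intDegree] at hA
  have hle : A.num.natDegree ≤ A.denom.natDegree := by omega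
  set n := A.denom.natDegree with hn
  have key : ∀ p : ℂ[X], p.natDegree ≤ n →
      algebraMap ℂ[X] (RatFunc ℂ) (reflect n p) =
        aeval (RatFunc.X⁻¹ : RatFunc ℂ) p * RatFunc.X ^ n := by
    intro p hp
    have hX : (RatFunc.X : RatFunc ℂ) ≠ 0 := RatFunc.X_ne_zero
    let _ : Invertible (RatFunc.X⁻¹ : RatFunc ℂ) := invertibleOfNonzero (inv_ne_zero hX)
    have h1 := eval₂_reflect_mul_pow (algebraMap ℂ (RatFunc ℂ)) (RatFunc.X⁻¹ : RatFunc ℂ) n p hp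
    rw [invOf_eq_inv, inv_inv, ← aeval_def, ← aeval_def,
      RatFunc.aeval_X_left_eq_algebraMap] at h1
    rw [← h1, mul_assoc, ← mul_pow, inv_mul_cancel₀ hX, one_pow, mul_one]
  -- The value at 0 of the reversed denominator is the leading coefficient of the original one.
  refine ⟨reflect n A.num, reflect n A.denom, ?_, ?_⟩
  · rw [← coeff_zero_eq_eval_zero, coeff_reflect, revAt_le (Nat.zero_le _), Nat.sub_zero, hn]
    exact leadingCoeff_ne_zero.2 A.denom_ne_zero
  · rw [key _ hle, key _ le_rfl]
    have hinv : invX A = aeval (RatFunc.X⁻¹ : RatFunc ℂ) A.num /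
        aeval (RatFunc.X⁻¹ : RatFunc ℂ) A.denom := by
      rw [← invX_algebraMap, ← invX_algebraMap, ← map_div₀, RatFunc.num_div_denom]
    have : aeval (RatFunc.X⁻¹ : RatFunc ℂ) A.denom ≠ 0 := by
      rw [← invX_algebraMap]
      exact (_root_.map_ne_zero _).2 (RatFunc.algebraMap_ne_zero A.denom_ne_zero)
    rw [hinv, ← mul_assoc, div_mul_cancel₀ _ this]

/-- K is separable over ℂ(x), a localization of ℂ[x]; so K is formally étale over ℂ[x] and dx is a
basis of its differentials. This permits cancelling dx. -/
theorem QuinticModel.D_X_ne_zero {K : Type} [Field K] [Algebra ℂ K] (m : QuinticModel K) :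
    KaehlerDifferential.D ℂ K (m.φ RatFunc.X) ≠ 0 := by
  let _ : Algebra (RatFunc ℂ) K := m.φ.toRingHom.toAlgebra
  let _ : Algebra ℂ[X] K := ((m.φ.toRingHom).comp (algebraMap ℂ[X] (RatFunc ℂ))).toAlgebra
  have : IsScalarTower ℂ[X] (RatFunc ℂ) K := IsScalarTower.of_algebraMap_eq' rfl
  have : IsScalarTower ℂ (RatFunc ℂ) K :=
    IsScalarTower.of_algebraMap_eq fun c => (m.φ.commutes c).symm
  have : IsScalarTower ℂ ℂ[X] K := by
    refine IsScalarTower.of_algebraMap_eq fun c => ?_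
    change _ = m.φ (algebraMap ℂ[X] (RatFunc ℂ) (algebraMap ℂ ℂ[X] c))
    rw [← IsScalarTower.algebraMap_apply, m.φ.commutes]
  have : Algebra.IsIntegral (RatFunc ℂ) K := by
    refine ⟨fun z => ?_⟩
    obtain ⟨A, B, rfl⟩ := m.exists_eq z
    have hy : IsIntegral (RatFunc ℂ) m.y := by
      refine ⟨X ^ 2 - C (algebraMap ℂ[X] (RatFunc ℂ) m.g), monic_X_pow_sub_C _ two_ne_zero, ?_⟩
      simp only [eval₂_sub, eval₂_pow, eval₂_X, eval₂_C, m.sq_y]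
      exact sub_self _
    have hA : ∀ A, IsIntegral (RatFunc ℂ) (m.φ A) := fun A => isIntegral_algebraMap (x := A)
    exact (hA A).add ((hA B).mul hy)
  have : Algebra.FormallyEtale (RatFunc ℂ) K := Algebra.FormallyEtale.of_isSeparable _ _
  have : Algebra.FormallyEtale ℂ[X] (RatFunc ℂ) :=
    Algebra.FormallyEtale.of_isLocalization (nonZeroDivisors ℂ[X])
  have : Algebra.FormallyEtale ℂ[X] K := Algebra.FormallyEtale.comp ℂ[X] (RatFunc ℂ) K
  intro h0
  have hX : m.φ RatFunc.X = algebraMap ℂ[X] K X := by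
    rw [← RatFunc.algebraMap_X]; rfl
  rw [hX] at h0
  have h1 := KaehlerDifferential.tensorKaehlerEquivOfFormallyEtale_symm_D_algebraMap ℂ ℂ[X] K X
  rw [h0, map_zero] at h1
  have h2 := congrArg (TensorProduct.rid ℂ[X] K ∘ (LinearMap.lTensor K
    (KaehlerDifferential.polynomialEquiv ℂ).toLinearMap)) h1
  simp at h2

theorem mu_sq (b : Fin 4 → ℝ) : mu b ^ 2 =
    algebraMap (RatFunc ℂ) (FunctionField b) (algebraMap ℂ[X] (RatFunc ℂ) (curvePoly b)) := by
  have h : (aeval (AdjoinRoot.root (definingPoly b)))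
      (X ^ 2 - C (algebraMap ℂ[X] (RatFunc ℂ) (curvePoly b))) = 0 := by
    rw [AdjoinRoot.aeval_eq]
    exact AdjoinRoot.mk_self
  rw [map_sub, map_pow, aeval_X, aeval_C] at h
  exact sub_eq_zero.1 h

theorem exists_eq_add_mul_mu (b : Fin 4 → ℝ) (z : FunctionField b) :
    ∃ A B : RatFunc ℂ, z = algebraMap (RatFunc ℂ) (FunctionField b) A +
      algebraMap (RatFunc ℂ) (FunctionField b) B * mu b := by
  obtain ⟨p, rfl⟩ := AdjoinRoot.mk_surjective (g := definingPoly b) z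
  have hp : AdjoinRoot.mk (definingPoly b) p = eval₂ (algebraMap (RatFunc ℂ) (FunctionField b))
      (mu b) p := (AdjoinRoot.aeval_eq p).symm
  rw [hp]
  clear hp
  induction p using Polynomial.induction_on with
  | C a => exact ⟨a, 0, by simp⟩
  | add p q hp hq =>
    obtain ⟨A, B, h⟩ := hp
    obtain ⟨A', B', h'⟩ := hq
    exact ⟨A + A', B + B', by rw [eval₂_add, h, h', map_add, map_add]; ring⟩
  | monomial n a ih =>
    obtain ⟨A, B, h⟩ := ih
    refine ⟨B * algebraMap ℂ[X] (RatFunc ℂ) (curvePoly b), A, ?_⟩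
    rw [pow_succ, ← mul_assoc, eval₂_mul, h, eval₂_X, map_mul, ← mu_sq]
    ring

theorem squarefree_prod_X_sub_C {t : Fin 5 → ℂ} (ht : Function.Injective t) :
    Squarefree (∏ i, (X - C (t i))) :=
  (separable_prod_X_sub_C_iff.2 ht).squarefree

/-- The presentation of `ℂ(Γ)` by the coordinates `λ, μ`. -/
noncomputable def lamModel (b : Fin 4 → ℝ) (hb : Function.Injective b) (hb0 : ∀ k, b k ≠ 0) :
    QuinticModel (FunctionField b) where
  φ := IsScalarTower.toAlgHom ℂ (RatFunc ℂ) (FunctionField b)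
  y := mu b
  g := curvePoly b
  sq_y := mu_sq b
  natDegree_g := natDegree_curvePoly b
  squarefree_g := by
    have h : curvePoly b =
        -∏ i : Fin 5, (X - C ((Fin.cons 0 (fun k => (b k : ℂ)) : Fin 5 → ℂ) i)) := by
      simp [curvePoly, Fin.prod_univ_succ, Fin.cons]
    have hinj : Function.Injective (Fin.cons 0 (fun k => (b k : ℂ)) : Fin 5 → ℂ) := by
      rw [Fin.cons_injective_iff]
      refine ⟨?_, fun i j hij => hb (Complex.ofReal_injective hij)⟩
      rintro ⟨k, hk⟩
      exact hb0 k (Complex.ofReal_eq_zero.1 hk)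
    rw [h]
    exact fun x hx => squarefree_prod_X_sub_C hinj x ((dvd_neg).1 hx)
  exists_eq := exists_eq_add_mul_mu b

theorem lam_ne_zero (b : Fin 4 → ℝ) : lam b ≠ 0 :=
  (_root_.map_ne_zero _).2 RatFunc.X_ne_zero

/-- The inverses of the branch points, in increasing order. -/
noncomputable def nodes (b : Fin 4 → ℝ) : Fin 5 → ℝ :=
  ![0, 1 / b 3, 1 / b 2, 1 / b 1, 1 / b 0]

theorem aeval_lam (b : Fin 4 → ℝ) (p : ℂ[X]) : aeval (lam b) p =
    algebraMap (RatFunc ℂ) (FunctionField b) (algebraMap ℂ[X] (RatFunc ℂ) p) := by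
  rw [← RatFunc.aeval_X_left_eq_algebraMap]
  exact aeval_algHom_apply (IsScalarTower.toAlgHom ℂ (RatFunc ℂ) (FunctionField b)) RatFunc.X p

/-- The presentation of `ℂ(Γ)` by the coordinates `x = 1/λ`, `y = μ/λ³`. -/
noncomputable def xModel (b : Fin 4 → ℝ) (hb : Function.Injective (nodes b))
    (hb0 : ∀ k, b k ≠ 0) : QuinticModel (FunctionField b) where
  φ := (IsScalarTower.toAlgHom ℂ (RatFunc ℂ) (FunctionField b)).comp invX
  y := mu b / lam b ^ 3
  g := C (-∏ k, (b k : ℂ)) * ∏ i, (X - C (nodes b i : ℂ))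
  sq_y := by
    have hl := lam_ne_zero b
    have h1 : ((IsScalarTower.toAlgHom ℂ (RatFunc ℂ) (FunctionField b)).comp invX)
        (algebraMap ℂ[X] (RatFunc ℂ) (C (-∏ k, (b k : ℂ)) * ∏ i, (X - C (nodes b i : ℂ)))) =
        aeval (lam b)⁻¹ (C (-∏ k, (b k : ℂ)) * ∏ i, (X - C (nodes b i : ℂ))) := by
      rw [AlgHom.comp_apply, invX_algebraMap, ← aeval_algHom_apply, map_inv₀]
      rfl
    rw [h1, div_pow, mu_sq, ← aeval_lam, curvePoly]
    have hb0' : ∀ k, algebraMap ℂ (FunctionField b) (b k : ℂ) ≠ 0 := fun k =>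
      (_root_.map_ne_zero _).2 (by exact_mod_cast hb0 k)
    have e0 := hb0' 0
    have e1 := hb0' 1
    have e2 := hb0' 2
    have e3 := hb0' 3
    simp only [Fin.prod_univ_four, Fin.prod_univ_five, nodes, map_mul, map_neg, map_sub, aeval_X,
      aeval_C, Matrix.cons_val, Complex.ofReal_zero, Complex.ofReal_div, Complex.ofReal_one,
      map_div₀, map_one, map_zero]
    field_simp
    ring
  natDegree_g := by
    have hne : (-∏ k, (b k : ℂ)) ≠ 0 :=
      neg_ne_zero.2 (Finset.prod_ne_zero_iff.2 fun k _ => by exact_mod_cast hb0 k)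
    rw [natDegree_C_mul hne, natDegree_prod_of_monic _ _ fun k _ => monic_X_sub_C _]
    simp
  squarefree_g := by
    have hne : (-∏ k, (b k : ℂ)) ≠ 0 :=
      neg_ne_zero.2 (Finset.prod_ne_zero_iff.2 fun k _ => by exact_mod_cast hb0 k)
    have hu : IsUnit (C (-∏ k, (b k : ℂ))) := isUnit_C.2 (isUnit_iff_ne_zero.2 hne)
    have hs := squarefree_prod_X_sub_C (t := fun i => (nodes b i : ℂ))
      (fun i j hij => hb (Complex.ofReal_injective hij))
    exact fun x hx => hs x ((hu.dvd_mul_left).1 hx)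
  exists_eq := by
    intro z
    obtain ⟨A, B, rfl⟩ := exists_eq_add_mul_mu b z
    refine ⟨invX A, invX (B * RatFunc.X ^ 3), ?_⟩
    rw [AlgHom.comp_apply, AlgHom.comp_apply, invX_invX, invX_invX]
    have hl := lam_ne_zero b
    have h1 : (IsScalarTower.toAlgHom ℂ (RatFunc ℂ) (FunctionField b)) (B * RatFunc.X ^ 3) =
        algebraMap (RatFunc ℂ) (FunctionField b) B * lam b ^ 3 := by
      rw [map_mul, map_pow]; rfl
    rw [h1, mul_assoc, mul_div_cancel₀ _ (pow_ne_zero 3 hl)]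
    rfl

theorem xModel_φ_X (b : Fin 4 → ℝ) (hb : Function.Injective (nodes b)) (hb0 : ∀ k, b k ≠ 0) :
    (xModel b hb hb0).φ RatFunc.X = (lam b)⁻¹ := by
  change algebraMap (RatFunc ℂ) (FunctionField b) (invX RatFunc.X) = _
  rw [invX_X, map_inv₀]
  rfl

theorem omega_one_eq (b : Fin 4 → ℝ) (hb : Function.Injective (nodes b)) (hb0 : ∀ k, b k ≠ 0) :
    omega b 1 = (-(xModel b hb hb0).y⁻¹) •
      KaehlerDifferential.D ℂ (FunctionField b) ((xModel b hb hb0).φ RatFunc.X) := by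
  have hl := lam_ne_zero b
  rw [xModel_φ_X, Derivation.leibniz_inv, smul_smul, omega]
  congr 1
  change lam b ^ 1 / mu b = -(mu b / lam b ^ 3)⁻¹ * -(lam b)⁻¹ ^ 2
  rw [inv_div]
  field_simp

/-- A polynomial in `λ, μ` in the form `A(λ) + B(λ) μ`. -/
theorem exists_aeval_eq (b : Fin 4 → ℝ) (f : MvPolynomial (Fin 2) ℂ) :
    ∃ A B : ℂ[X], MvPolynomial.aeval ![lam b, mu b] f = aeval (lam b) A + aeval (lam b) B * mu b ∧
      A.eval 0 = MvPolynomial.eval 0 f := by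
  induction f using MvPolynomial.induction_on with
  | C a => exact ⟨C a, 0, by simp, by simp⟩
  | add p q hp hq =>
    obtain ⟨A, B, h, h0⟩ := hp
    obtain ⟨A', B', h', h0'⟩ := hq
    exact ⟨A + A', B + B', by rw [map_add, h, h', map_add, map_add]; ring,
      by rw [eval_add, h0, h0', map_add]⟩
  | mul_X p i hp =>
    obtain ⟨A, B, h, h0⟩ := hp
    fin_cases i
    · refine ⟨A * X, B * X, ?_, by simp⟩
      rw [map_mul, h, MvPolynomial.aeval_X, map_mul, map_mul, aeval_X]
      simp only [Fin.zero_eta, Matrix.cons_val_zero]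
      ring
    · refine ⟨B * curvePoly b, A, ?_, by simp [curvePoly]⟩
      rw [map_mul, h, MvPolynomial.aeval_X, map_mul, aeval_lam b (curvePoly b), ← mu_sq]
      simp only [Fin.mk_one, Matrix.cons_val_one, Matrix.cons_val_fin_one]
      ring

/-- Regularity writes z as a₁/d₁ + (a₂/d₂)μ, fractions in λ with dᵢ(0) ≠ 0. Clearing denominators in
z p = q and taking the μ-free part at λ = 0 gives q(P₀) = 0, since μ² and p vanish at P₀. -/
theorem not_isRegularAtInfty_of_hasPole (b : Fin 4 → ℝ) (hb : Function.Injective (nodes b))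
    (hb' : Function.Injective b) (hb0 : ∀ k, b k ≠ 0) {z : FunctionField b}
    (hz : HasPoleAtP0 b z) : ¬ (xModel b hb hb0).IsRegularAtInfty z := by
  rintro ⟨A, B, hAB, hA, hB⟩
  obtain ⟨p, q, hp0, hq0, hpq⟩ := hz
  have hl := lam_ne_zero b
  have hB' : (B * RatFunc.X ^ 3).intDegree ≤ 0 := by
    rcases hB with rfl | hB
    · simp
    · by_cases hB0 : B = 0
      · simp [hB0]
      have h3 : (RatFunc.X ^ 3 : RatFunc ℂ).intDegree = 3 := by
        rw [← RatFunc.algebraMap_X, ← map_pow, RatFunc.intDegree_polynomial, natDegree_X_pow]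
        rfl
      rw [RatFunc.intDegree_mul hB0 (pow_ne_zero 3 RatFunc.X_ne_zero), h3]
      omega
  have hz' : z = algebraMap (RatFunc ℂ) (FunctionField b) (invX A) +
      algebraMap (RatFunc ℂ) (FunctionField b) (invX (B * RatFunc.X ^ 3)) * mu b := by
    rw [hAB]
    change algebraMap (RatFunc ℂ) (FunctionField b) (invX A) +
      algebraMap (RatFunc ℂ) (FunctionField b) (invX B) * (mu b / lam b ^ 3) = _
    rw [map_mul invX, map_pow, invX_X, map_mul, map_pow, map_inv₀, ← lam]
    field_simp
  obtain ⟨a₁, d₁, hd₁, h₁⟩ := exists_invX_mul_eq hA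
  obtain ⟨a₂, d₂, hd₂, h₂⟩ := exists_invX_mul_eq hB'
  obtain ⟨P₀, P₁, hP, hP0⟩ := exists_aeval_eq b p
  obtain ⟨Q₀, Q₁, hQ, hQ0⟩ := exists_aeval_eq b q
  have h₁' := congrArg (algebraMap (RatFunc ℂ) (FunctionField b)) h₁
  have h₂' := congrArg (algebraMap (RatFunc ℂ) (FunctionField b)) h₂
  rw [map_mul, ← aeval_lam, ← aeval_lam] at h₁' h₂'
  rw [hP, hQ, hz'] at hpq
  have hμ := mu_sq b
  rw [← aeval_lam] at hμ
  have key : aeval (lam b) (a₁ * d₂ * P₀ + a₂ * d₁ * P₁ * curvePoly b - d₁ * d₂ * Q₀) +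
      aeval (lam b) (a₁ * d₂ * P₁ + a₂ * d₁ * P₀ - d₁ * d₂ * Q₁) * mu b = 0 := by
    rw [map_sub, map_add, map_sub, map_add]
    simp only [map_mul (aeval (R := ℂ) (lam b)), ← h₁', ← h₂', ← hμ]
    linear_combination aeval (lam b) d₁ * aeval (lam b) d₂ * hpq
  rw [aeval_lam, aeval_lam] at key
  have h3 := ((lamModel b hb' hb0).eq_zero_of_add_eq_zero key).1
  have h4 := congrArg (eval 0)
    (IsFractionRing.injective ℂ[X] (RatFunc ℂ) (h3.trans (map_zero _).symm))
  have hc : (curvePoly b).eval 0 = 0 := by simp [curvePoly]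
  simp only [eval_sub, eval_add, eval_mul, hP0, hQ0, hp0, hc, mul_zero, add_zero, eval_zero,
    zero_sub, neg_eq_zero, mul_eq_zero] at h4
  tauto

/-- The equation of `Γ` in the coordinate `1/λ` when `(Γ, P₀)` is a tangential cover of
degree `3`. -/
theorem exists_form_of_tangentialCover (b : Fin 4 → ℝ) (hb : Function.Injective (nodes b))
    (hb' : Function.Injective b) (hb0 : ∀ k, b k ≠ 0)
    (h : IsHyperellipticTangentialCover b 3) :
    ∃ ρ s γ c : ℂ, s ≠ 0 ∧ C (-∏ k, (b k : ℂ)) * ∏ i, (X - C (nodes b i : ℂ)) =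
      C γ * ((X - C ρ) ^ 2 - C (s ^ 2)) *
        ((X - C ρ) ^ 3 - C (3 / 4 * s ^ 2) * (X - C ρ) + C c) := by
  obtain ⟨π, hdeg, hpt, c, -, hc⟩ := h
  obtain ⟨f, hf, htr⟩ := hc 1
  have h0 : tangentVector b 1 = 0 := rfl
  rw [h0, mul_zero, map_zero] at htr
  rw [omega_one_eq b hb hb0] at hf
  exact (xModel b hb hb0).exists_branch_form π hdeg
    (not_isRegularAtInfty_of_hasPole b hb hb' hb0 hpt) (xModel b hb hb0).D_X_ne_zero hf htr

/-! ### Position of the real roots -/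

/-- v and w are the two roots of a quadratic in t with discriminant 3(S - u²) = (v - w)² > 0. -/
theorem sq_lt_of_quadratic {u v w S : ℝ} (hvw : v ≠ w)
    (hv : u ^ 2 + u * v + v ^ 2 = 3 / 4 * S) (hw : u ^ 2 + u * w + w ^ 2 = 3 / 4 * S) :
    u ^ 2 < S := by
  have h0 : u + v + w = 0 := by
    refine (mul_eq_zero.1 (?_ : (v - w) * (u + v + w) = 0)).resolve_left (sub_ne_zero.2 hvw)
    linear_combination hv - hw
  have h1 : 0 < (v - w) ^ 2 := by have := sub_ne_zero.2 hvw; positivity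
  nlinarith [h1, h0]

/-- The real roots of the quintic of a tangential cover: the outermost two are symmetric about the
barycentre of the other three. -/
theorem quadratic_relations {t : Fin 5 → ℝ} (ht : StrictMono t) {δ ρ s γ c : ℂ} (hδ : δ ≠ 0)
    (hs : s ≠ 0)
    (h : C δ * ∏ i, (X - C (t i : ℂ)) = C γ * ((X - C ρ) ^ 2 - C (s ^ 2)) *
        ((X - C ρ) ^ 3 - C (3 / 4 * s ^ 2) * (X - C ρ) + C c)) :
    ∀ k l : Fin 5, k ≠ l → k ≠ 0 → k ≠ 4 → l ≠ 0 → l ≠ 4 →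
      (t k - (t 0 + t 4) / 2) ^ 2 + (t k - (t 0 + t 4) / 2) * (t l - (t 0 + t 4) / 2)
        + (t l - (t 0 + t 4) / 2) ^ 2 = 3 / 4 * ((t 4 - t 0) / 2) ^ 2 := by
  have hev : ∀ x : ℂ, δ * ∏ i, (x - t i) =
      γ * ((x - ρ) ^ 2 - s ^ 2) * ((x - ρ) ^ 3 - 3 / 4 * s ^ 2 * (x - ρ) + c) := by
    intro x
    simpa [eval_prod] using congrArg (eval x) h
  have hroot : ∀ x : ℂ, (x - ρ) ^ 2 = s ^ 2 → ∃ i, x = t i := by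
    intro x hx
    have h1 := hev x
    rw [hx, sub_self, mul_zero, zero_mul] at h1
    obtain ⟨i, -, hi⟩ := Finset.prod_eq_zero_iff.1 ((mul_eq_zero.1 h1).resolve_left hδ)
    exact ⟨i, sub_eq_zero.1 hi⟩
  -- ρ ± s are among the real nodes, so ρ and s are real.
  obtain ⟨i, hi⟩ := hroot (ρ + s) (by ring)
  obtain ⟨j, hj⟩ := hroot (ρ - s) (by ring)
  have hγ : γ ≠ 0 := by
    rintro rfl
    rw [C_0, zero_mul, zero_mul] at h
    refine mul_ne_zero (C_ne_zero.2 hδ) ?_ h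
    exact (monic_prod_of_monic _ _ fun k _ => monic_X_sub_C _).ne_zero
  have hρ : ρ = (((t i + t j) / 2 : ℝ) : ℂ) := by
    push_cast
    rw [← hi, ← hj]; ring
  have hs' : s = (((t i - t j) / 2 : ℝ) : ℂ) := by
    push_cast
    rw [← hi, ← hj]; ring
  have hcubic : ∀ k, k ≠ i → k ≠ j →
      ((t k : ℂ) - ρ) ^ 3 - 3 / 4 * s ^ 2 * ((t k : ℂ) - ρ) + c = 0 := by
    intro k hki hkj
    have h1 := hev (t k)
    rw [Finset.prod_eq_zero (Finset.mem_univ k) (sub_self _), mul_zero] at h1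
    refine (mul_eq_zero.1 h1.symm).resolve_left (mul_ne_zero hγ ?_)
    intro h2
    have h3 : ((t k : ℂ) - (ρ + s)) * ((t k : ℂ) - (ρ - s)) = 0 := by linear_combination h2
    rw [hi, hj] at h3
    rcases mul_eq_zero.1 h3 with h4 | h4
    · exact hki (ht.injective (Complex.ofReal_injective (sub_eq_zero.1 h4)))
    · exact hkj (ht.injective (Complex.ofReal_injective (sub_eq_zero.1 h4)))
  have hquad : ∀ k l, k ≠ l → k ≠ i → k ≠ j → l ≠ i → l ≠ j →
      (t k - (t i + t j) / 2) ^ 2 + (t k - (t i + t j) / 2) * (t l - (t i + t j) / 2)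
        + (t l - (t i + t j) / 2) ^ 2 = 3 / 4 * ((t i - t j) / 2) ^ 2 := by
    intro k l hkl hki hkj hli hlj
    have h1 := hcubic k hki hkj
    have h2 := hcubic l hli hlj
    have h3 : (t k : ℂ) - t l ≠ 0 := by
      intro h0
      exact hkl (ht.injective (Complex.ofReal_injective (sub_eq_zero.1 h0)))
    have h4 : ((t k : ℂ) - ρ) ^ 2 + ((t k : ℂ) - ρ) * ((t l : ℂ) - ρ) + ((t l : ℂ) - ρ) ^ 2 =
        3 / 4 * s ^ 2 := by
      refine mul_left_cancel₀ h3 ?_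
      linear_combination h1 - h2
    rw [hρ, hs'] at h4
    apply Complex.ofReal_injective
    push_cast at h4 ⊢
    exact h4
  -- Using the other two roots of the cubic, (t_k - ρ)² < s²; hence the pair i, j is outermost.
  have hbetween : ∀ k, k ≠ i → k ≠ j → (t k - t i) * (t k - t j) < 0 := by
    intro k hki hkj
    have hex : ∀ i j k : Fin 5, ∃ l r : Fin 5, l ≠ r ∧ k ≠ l ∧ k ≠ r ∧ l ≠ i ∧ l ≠ j ∧ r ≠ i ∧
        r ≠ j := by decide
    obtain ⟨l, r, hlr, hkl, hkr, hli, hlj, hri, hrj⟩ := hex i j k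
    have := sq_lt_of_quadratic (fun h0 => hlr (ht.injective (sub_left_injective h0)))
      (hquad k l hkl hki hkj hli hlj) (hquad k r hkr hki hkj hri hrj)
    nlinarith [this]
  have hij : i ≠ j := by
    rintro rfl
    rw [sub_self, zero_div, Complex.ofReal_zero] at hs'
    exact hs hs'
  have h0 : i = 0 ∨ j = 0 := by
    by_contra hcon
    push Not at hcon
    have h1 := ht (Fin.pos_of_ne_zero hcon.1)
    have h2 := ht (Fin.pos_of_ne_zero hcon.2)
    nlinarith [hbetween 0 (Ne.symm hcon.1) (Ne.symm hcon.2)]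
  have h4 : i = 4 ∨ j = 4 := by
    by_contra hcon
    push Not at hcon
    have h1 := ht (show i < 4 by omega)
    have h2 := ht (show j < 4 by omega)
    nlinarith [hbetween 4 (Ne.symm hcon.1) (Ne.symm hcon.2)]
  intro k l hkl hk0 hk4 hl0 hl4
  have hcases : (i = 0 ∧ j = 4) ∨ (i = 4 ∧ j = 0) := by omega
  rcases hcases with ⟨rfl, rfl⟩ | ⟨rfl, rfl⟩
  · rw [hquad k l hkl hk0 hk4 hl0 hl4]; ring
  · have := hquad k l hkl hk4 hk0 hl4 hl0
    rw [add_comm (t 4) (t 0)] at this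
    exact this

/-! ### The angle substitution and the periods of ω₂ -/

section

open Set MeasureTheory Real

/-- The coordinate `λ = 1 / (M (1 + cos θ))` in terms of an angle. -/
noncomputable def angleCoord (M θ : ℝ) : ℝ := (M * (1 + cos θ))⁻¹

theorem one_add_cos_pos {θ : ℝ} (h0 : 0 ≤ θ) (hπ : θ < π) : 0 < 1 + cos θ := by
  have := Real.strictAntiOn_cos ⟨h0, hπ.le⟩ ⟨pi_pos.le, le_rfl⟩ hπ
  rw [cos_pi] at this
  linarith

theorem hasDerivAt_angleCoord {M θ : ℝ} (hM : 0 < M) (h0 : 0 ≤ θ) (hπ : θ < π) :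
    HasDerivAt (angleCoord M) (sin θ / (M * (1 + cos θ) ^ 2)) θ := by
  have h1 := one_add_cos_pos h0 hπ
  have h2 := ((hasDerivAt_cos θ).const_add 1).const_mul M
  refine (h2.inv (mul_pos hM h1).ne').congr_deriv ?_
  field_simp

theorem strictMonoOn_angleCoord {M : ℝ} (hM : 0 < M) : StrictMonoOn (angleCoord M) (Ico 0 π) := by
  intro x hx y hy hxy
  have h1 := Real.strictAntiOn_cos ⟨hx.1, hx.2.le⟩ ⟨hy.1, hy.2.le⟩ hxy
  have h2 := one_add_cos_pos hy.1 hy.2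
  unfold angleCoord
  gcongr

theorem image_angleCoord {M α β : ℝ} (hM : 0 < M) (hα : 0 ≤ α) (hαβ : α < β) (hβ : β < π) :
    angleCoord M '' Ioo α β = Ioo (angleCoord M α) (angleCoord M β) := by
  have hmono := strictMonoOn_angleCoord hM
  apply Subset.antisymm
  · rintro _ ⟨θ, hθ, rfl⟩
    exact ⟨hmono ⟨hα, hαβ.trans hβ⟩ ⟨hα.trans hθ.1.le, hθ.2.trans hβ⟩ hθ.1,
      hmono ⟨hα.trans hθ.1.le, hθ.2.trans hβ⟩ ⟨hα.trans hαβ.le, hβ⟩ hθ.2⟩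
  · refine intermediate_value_Ioo hαβ.le fun θ hθ => ?_
    exact (hasDerivAt_angleCoord hM (hα.trans hθ.1)
      (hθ.2.trans_lt hβ)).continuousAt.continuousWithinAt

/-- The substitution `x = 1 / (M (1 + cos θ))` for integrals over an interval. -/
theorem integral_angleCoord {M α β : ℝ} (hM : 0 < M) (hα : 0 ≤ α) (hαβ : α < β) (hβ : β < π)
    {G K : ℝ → ℝ}
    (hGK : ∀ θ ∈ Ioo α β, sin θ / (M * (1 + cos θ) ^ 2) * G (angleCoord M θ) = K θ) :
    (IntegrableOn G (Ioo (angleCoord M α) (angleCoord M β)) ↔ IntegrableOn K (Ioo α β)) ∧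
      ∫ x in Ioo (angleCoord M α) (angleCoord M β), G x = ∫ θ in Ioo α β, K θ := by
  have hd : ∀ θ ∈ Ioo α β, HasDerivWithinAt (angleCoord M) (sin θ / (M * (1 + cos θ) ^ 2))
      (Ioo α β) θ := fun θ hθ =>
    (hasDerivAt_angleCoord hM (hα.trans hθ.1.le) (hθ.2.trans hβ)).hasDerivWithinAt
  have hinj : InjOn (angleCoord M) (Ioo α β) :=
    ((strictMonoOn_angleCoord hM).mono fun θ hθ =>
      ⟨hα.trans hθ.1.le, hθ.2.trans hβ⟩).injOn
  have hK : EqOn (fun θ => |sin θ / (M * (1 + cos θ) ^ 2)| • G (angleCoord M θ)) K (Ioo α β) := by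
    intro θ hθ
    have h1 : 0 ≤ sin θ / (M * (1 + cos θ) ^ 2) :=
      div_nonneg (sin_nonneg_of_nonneg_of_le_pi (hα.trans hθ.1.le) (hθ.2.trans hβ).le)
        (mul_nonneg hM.le (sq_nonneg _))
    simp only [abs_of_nonneg h1, smul_eq_mul]
    exact hGK θ hθ
  rw [← image_angleCoord hM hα hαβ hβ]
  refine ⟨?_, ?_⟩
  · rw [integrableOn_image_iff_integrableOn_abs_deriv_smul measurableSet_Ioo hd hinj]
    exact integrableOn_congr_fun hK measurableSet_Ioo
  · rw [integral_image_eq_integral_abs_deriv_smul measurableSet_Ioo hd hinj]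
    exact setIntegral_congr_fun measurableSet_Ioo hK

/-- cos 3θ - cos 3a = 2 sin(3(a+θ)/2) sin(3(a-θ)/2). The first sine is bounded below since 3a < π,
and the second is at least a multiple of a - θ by Jordan's inequality, so (a - θ)^(-1/2) dominates.
-/
theorem integrableOn_inv_sqrt_cos {a : ℝ} (ha : 0 < a) (ha' : a < π / 3) :
    IntervalIntegrable (fun θ => 1 / √(cos (3 * θ) - cos (3 * a))) volume 0 a := by
  obtain ⟨x, hx, hmin⟩ := isCompact_Icc.exists_isMinOn (nonempty_Icc.2 ha.le)
    (f := fun θ => sin (3 * (a + θ) / 2)) (by fun_prop)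
  set m := sin (3 * (a + x) / 2) with hm
  have hm0 : 0 < m := sin_pos_of_pos_of_lt_pi (by linarith [hx.1]) (by linarith [hx.2])
  have hbound : ∀ θ ∈ Ioo 0 a, 2 * m * (3 / π) * (a - θ) ≤ cos (3 * θ) - cos (3 * a) := by
    intro θ hθ
    have h1 : cos (3 * θ) - cos (3 * a) = 2 * sin (3 * (a + θ) / 2) * sin (3 * (a - θ) / 2) := by
      rw [cos_sub_cos, show (3 * θ - 3 * a) / 2 = -(3 * (a - θ) / 2) by ring, sin_neg,
        show (3 * θ + 3 * a) / 2 = 3 * (a + θ) / 2 by ring]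
      ring
    have h2 : 3 / π * (a - θ) ≤ sin (3 * (a - θ) / 2) := by
      have := mul_le_sin (x := 3 * (a - θ) / 2) (by linarith [hθ.2]) (by linarith [hθ.1])
      calc 3 / π * (a - θ) = 2 / π * (3 * (a - θ) / 2) := by ring
        _ ≤ _ := this
    have h3 : m ≤ sin (3 * (a + θ) / 2) := hmin ⟨hθ.1.le, hθ.2.le⟩
    have h4 : 0 ≤ 3 / π * (a - θ) := mul_nonneg (by positivity) (by linarith [hθ.2])
    rw [h1]
    nlinarith [mul_le_mul h3 h2 h4 (hm0.le.trans h3)]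
  set c := 2 * m * (3 / π) with hc
  have hc0 : 0 < c := by positivity
  have hint : IntervalIntegrable (fun θ => 1 / √c * (a - θ) ^ (-(1 / 2) : ℝ)) volume 0 a := by
    have h1 := (intervalIntegral.intervalIntegrable_rpow' (a := a) (b := 0)
      (r := -(1 / 2)) (by norm_num)).comp_sub_left a
    rw [sub_self, sub_zero] at h1
    exact h1.const_mul _
  rw [intervalIntegrable_iff_integrableOn_Ioo_of_le ha.le] at hint ⊢
  refine Integrable.mono' hint (Measurable.aestronglyMeasurable (by fun_prop)) ?_
  refine (ae_restrict_iff' measurableSet_Ioo).2 (Filter.Eventually.of_forall fun θ hθ => ?_)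
  have h1 : 0 < a - θ := by linarith [hθ.2]
  rw [norm_of_nonneg (by positivity), rpow_neg h1.le, ← sqrt_eq_rpow, one_div, one_div,
    ← mul_inv, ← sqrt_mul hc0.le]
  have h2 : 0 < c * (a - θ) := mul_pos hc0 h1
  gcongr
  exact hbound θ hθ

theorem cos_two_pi_div_three : cos (2 * π / 3) = -(1 / 2) := by
  rw [show 2 * π / 3 = π - π / 3 by ring, cos_pi_sub, cos_pi_div_three]

theorem sin_two_pi_div_three : sin (2 * π / 3) = √3 / 2 := by
  rw [show 2 * π / 3 = π - π / 3 by ring, sin_pi_sub, sin_pi_div_three]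

/-- The three angles a and 2π/3 ± a have the same cos 3φ, so their cosines are the roots of 4X³ - 3X
- cos 3a. -/
theorem prod_cos_sub_cos (θ a : ℝ) :
    (cos θ - cos a) * (cos θ - cos (2 * π / 3 - a)) * (cos θ - cos (2 * π / 3 + a)) =
      (cos (3 * θ) - cos (3 * a)) / 4 := by
  have h3 : √3 ^ 2 = (3 : ℝ) := sq_sqrt (by norm_num)
  have hs := sin_sq_add_cos_sq a
  rw [cos_sub, cos_add, cos_two_pi_div_three, sin_two_pi_div_three, cos_three_mul, cos_three_mul]
  linear_combination (-(1 / 4) * (cos θ - cos a) * sin a ^ 2) * h3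
    - (3 / 4) * (cos θ - cos a) * hs

/-- The branch points of `Γ` in terms of an angle. -/
noncomputable def angleBranchPoints (M a : ℝ) : Fin 4 → ℝ :=
  ![angleCoord M 0, angleCoord M a, angleCoord M (2 * π / 3 - a), angleCoord M (2 * π / 3 + a)]

/-- The pull-back of `ω₂` under `λ = 1 / (M (1 + cos θ))`. -/
theorem omega_angleCoord {M a θ : ℝ} (hM : 0 < M) (ha : 0 < a) (ha' : a < π / 3) (h0 : 0 < θ)
    (hπ : θ < π) :
    sin θ / (M * (1 + cos θ) ^ 2) * (angleCoord M θ ^ 1 /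
        √(-(angleCoord M θ * ∏ k, (angleCoord M θ - angleBranchPoints M a k)))) =
      √(4 / (M ^ 3 * ∏ k, angleBranchPoints M a k)) *
        (1 / √(cos (3 * θ) - cos (3 * a))) := by
  have hpos : ∀ φ, 0 ≤ φ → φ < π → 0 < 1 + cos φ := fun φ => one_add_cos_pos
  have p0 : 0 < 1 + cos (0 : ℝ) := hpos 0 le_rfl pi_pos
  have p1 := hpos a ha.le (by linarith)
  have p2 := hpos (2 * π / 3 - a) (by linarith) (by linarith)
  have p3 := hpos (2 * π / 3 + a) (by linarith) (by linarith)
  have pθ := hpos θ h0.le hπ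
  have hsin : 0 < sin θ := sin_pos_of_pos_of_lt_pi h0 hπ
  have hbpos : ∀ φ, 0 < 1 + cos φ → 0 < angleCoord M φ := fun φ h => inv_pos.2 (mul_pos hM h)
  have hB : 0 < ∏ k, angleBranchPoints M a k := by
    simp only [Fin.prod_univ_four, angleBranchPoints, Matrix.cons_val]
    exact mul_pos (mul_pos (mul_pos (hbpos _ p0) (hbpos _ p1)) (hbpos _ p2)) (hbpos _ p3)
  have hsub : ∀ φ, 0 < 1 + cos φ → angleCoord M θ - angleCoord M φ =
      (cos φ - cos θ) * angleCoord M φ / (1 + cos θ) := by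
    intro φ hφ
    unfold angleCoord
    field_simp
    ring
  have hx : angleCoord M θ * (M * (1 + cos θ)) = 1 := inv_mul_cancel₀ (mul_pos hM pθ).ne'
  set x := angleCoord M θ with hxdef
  set B := ∏ k, angleBranchPoints M a k with hBdef
  set κ := √(4 / (M ^ 3 * B)) with hκ
  have hκ0 : 0 < κ := sqrt_pos.2 (by positivity)
  have hκ2 : κ ^ 2 = 4 / (M ^ 3 * B) := sq_sqrt (by positivity)
  have hx0 : 0 < x := hbpos θ pθ
  -- E is the factor for which the radicand equals E²(cos 3θ - cos 3a), so it cancels against the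
  -- Jacobian.
  set E := sin θ / (M * (1 + cos θ) ^ 2) * x / κ with hE
  have hE0 : 0 < E := by positivity
  have hprod : ∏ k, (x - angleBranchPoints M a k) =
      -((1 - cos θ) * ((cos (3 * θ) - cos (3 * a)) / 4)) * B / (1 + cos θ) ^ 4 := by
    rw [← prod_cos_sub_cos, hBdef]
    simp only [Fin.prod_univ_four, angleBranchPoints, Matrix.cons_val]
    rw [hsub _ p0, hsub _ p1, hsub _ p2, hsub _ p3, cos_zero]
    field_simp
    ring
  have hP : -(x * ∏ k, (x - angleBranchPoints M a k)) = E ^ 2 * (cos (3 * θ) - cos (3 * a)) := by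
    have hs : sin θ ^ 2 = (1 - cos θ) * (1 + cos θ) := by
      linear_combination sin_sq_add_cos_sq θ
    have hxe : x = 1 / (M * (1 + cos θ)) := by rw [eq_div_iff (mul_pos hM pθ).ne', hx]
    rw [hprod, hE, div_pow, hκ2, mul_pow, div_pow, hs, hxe]
    field_simp
  rw [hP, sqrt_mul (sq_nonneg _), sqrt_sq hE0.le, pow_one]
  have h1 : sin θ / (M * (1 + cos θ) ^ 2) * x = κ * E := by
    rw [hE]; field_simp
  rw [← mul_div_assoc, h1, mul_comm κ E, mul_div_mul_left _ _ hE0.ne', mul_one_div]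

/-- K is 2π/3-periodic and even: the second interval shifts to [-a, a], which folds to twice [0, a].
-/
theorem periods_angleBranchPoints {M a : ℝ} (hM : 0 < M) (ha : 0 < a) (ha' : a < π / 3)
    {b : Fin 4 → ℝ} (hb : b = angleBranchPoints M a) :
    IntervalIntegrable (fun x => x ^ 1 / √(-(x * ∏ k, (x - b k)))) volume (b 0) (b 1) ∧
    IntervalIntegrable (fun x => x ^ 1 / √(-(x * ∏ k, (x - b k)))) volume (b 2) (b 3) ∧
    (∫ x in (b 2)..(b 3), x ^ 1 / √(-(x * ∏ k, (x - b k)))) =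
      2 * ∫ x in (b 0)..(b 1), x ^ 1 / √(-(x * ∏ k, (x - b k))) := by
  set G : ℝ → ℝ := fun x => x ^ 1 / √(-(x * ∏ k, (x - b k))) with hG
  set κ := √(4 / (M ^ 3 * ∏ k, b k)) with hκ
  set K : ℝ → ℝ := fun θ => κ * (1 / √(cos (3 * θ) - cos (3 * a))) with hK
  have hGK : ∀ θ, 0 < θ → θ < π →
      sin θ / (M * (1 + cos θ) ^ 2) * G (angleCoord M θ) = K θ := by
    intro θ h0 hπ
    simp only [hG, hK, hκ, hb]
    exact omega_angleCoord hM ha ha' h0 hπ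
  have e0 : b 0 = angleCoord M 0 := by rw [hb]; rfl
  have e1 : b 1 = angleCoord M a := by rw [hb]; rfl
  have e2 : b 2 = angleCoord M (2 * π / 3 - a) := by rw [hb]; rfl
  have e3 : b 3 = angleCoord M (2 * π / 3 + a) := by rw [hb]; rfl
  have hmono := strictMonoOn_angleCoord hM
  have hπ := pi_pos
  have h01 : b 0 < b 1 := by
    rw [e0, e1]; exact hmono ⟨le_rfl, hπ⟩ ⟨ha.le, by linarith⟩ ha
  have h23 : b 2 < b 3 := by
    rw [e2, e3]
    exact hmono ⟨by linarith, by linarith⟩ ⟨by linarith, by linarith⟩ (by linarith)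
  obtain ⟨i01, s01⟩ := integral_angleCoord (G := G) (K := K) hM le_rfl ha (by linarith)
    fun θ hθ => hGK θ hθ.1 (by linarith [hθ.2])
  obtain ⟨i23, s23⟩ := integral_angleCoord (α := 2 * π / 3 - a) (β := 2 * π / 3 + a)
    (G := G) (K := K) hM (by linarith) (by linarith) (by linarith)
    fun θ hθ => hGK θ (by linarith [hθ.1]) (by linarith [hθ.2])
  have hK0 : IntervalIntegrable K volume 0 a := (integrableOn_inv_sqrt_cos ha ha').const_mul κ
  have hKeven : ∀ θ, K (-θ) = K θ := by
    intro θ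
    simp only [hK, mul_neg, cos_neg]
  have hKper : ∀ θ, K (θ - 2 * π / 3) = K θ := by
    intro θ
    simp only [hK]
    rw [show 3 * (θ - 2 * π / 3) = 3 * θ - 2 * π by ring, cos_sub_two_pi]
  have hKneg : IntervalIntegrable K volume (-a) 0 := by
    have := (hK0.comp_mul_left (c := -1)).symm
    simpa [hKeven, div_neg] using this
  have hKsym : IntervalIntegrable K volume (-a) a := hKneg.trans hK0
  have hKshift : IntervalIntegrable K volume (2 * π / 3 - a) (2 * π / 3 + a) := by
    have := hKsym.comp_sub_right (2 * π / 3)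
    simp only [hKper] at this
    rwa [add_comm, add_comm a, ← sub_eq_add_neg] at this
  have hint : ∫ θ in (2 * π / 3 - a)..(2 * π / 3 + a), K θ = 2 * ∫ θ in 0..a, K θ := by
    have h1 : ∫ θ in (2 * π / 3 - a)..(2 * π / 3 + a), K θ = ∫ θ in (-a)..a, K θ := by
      rw [← intervalIntegral.integral_congr (fun θ _ => hKper θ),
        intervalIntegral.integral_comp_sub_right]
      congr 1 <;> ring
    have h2 : ∫ θ in (-a)..0, K θ = ∫ θ in 0..a, K θ := by
      rw [← intervalIntegral.integral_congr (fun θ _ => hKeven θ),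
        intervalIntegral.integral_comp_neg]
      simp
    rw [h1, ← intervalIntegral.integral_add_adjacent_intervals hKneg hK0, h2, two_mul]
  refine ⟨?_, ?_, ?_⟩
  · rw [intervalIntegrable_iff_integrableOn_Ioo_of_le h01.le, e0, e1, i01,
      ← intervalIntegrable_iff_integrableOn_Ioo_of_le ha.le]
    exact hK0
  · rw [intervalIntegrable_iff_integrableOn_Ioo_of_le h23.le, e2, e3, i23,
      ← intervalIntegrable_iff_integrableOn_Ioo_of_le (by linarith)]
    exact hKshift
  · rw [intervalIntegral.integral_of_le h01.le, intervalIntegral.integral_of_le h23.le,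
      integral_Ioc_eq_integral_Ioo, integral_Ioc_eq_integral_Ioo, e0, e1, e2, e3, s01, s23,
      ← integral_Ioc_eq_integral_Ioo, ← integral_Ioc_eq_integral_Ioo,
      ← intervalIntegral.integral_of_le ha.le, ← intervalIntegral.integral_of_le (by linarith)]
    exact hint

/-! ### Angles of the branch points and comparison of periods -/

theorem strictMono_nodes {b : Fin 4 → ℝ} (hb : StrictMono b) (hb0 : 0 < b 0) :
    StrictMono (nodes b) := by
  have h01 : b 0 < b 1 := hb (by decide)
  have h12 : b 1 < b 2 := hb (by decide)
  have h23 : b 2 < b 3 := hb (by decide)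
  rw [Fin.strictMono_iff_lt_succ]
  intro i
  fin_cases i
  · exact one_div_pos.2 (by linarith)
  · exact one_div_lt_one_div_of_lt (by linarith) h23
  · exact one_div_lt_one_div_of_lt (by linarith) h12
  · exact one_div_lt_one_div_of_lt (by linarith) h01

/-- The relations say v₁ + v₂ + v₃ = 0 and (v₂ + v₃/2)² = (3/4)(1 - v₃²); with v₃ = cos a the
ordering picks the sign of the square root. -/
theorem exists_angle {v₁ v₂ v₃ : ℝ} (h12 : v₁ < v₂) (h23 : v₂ < v₃)
    (q12 : v₁ ^ 2 + v₁ * v₂ + v₂ ^ 2 = 3 / 4) (q13 : v₁ ^ 2 + v₁ * v₃ + v₃ ^ 2 = 3 / 4)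
    (q23 : v₂ ^ 2 + v₂ * v₃ + v₃ ^ 2 = 3 / 4) :
    ∃ a, 0 < a ∧ a < π / 3 ∧ v₃ = cos a ∧ v₂ = cos (2 * π / 3 - a) ∧
      v₁ = cos (2 * π / 3 + a) := by
  have hsum : v₁ + v₂ + v₃ = 0 := by
    refine (mul_eq_zero.1 (?_ : (v₂ - v₃) * (v₁ + v₂ + v₃) = 0)).resolve_left
      (sub_ne_zero.2 h23.ne)
    linear_combination q12 - q13
  have hsq : v₃ ^ 2 < 1 :=
    sq_lt_of_quadratic (v := v₁) (w := v₂) h12.ne (by linarith) (by linarith)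
  obtain ⟨hlt, hgt⟩ := abs_lt.1 ((sq_lt_one_iff_abs_lt_one v₃).1 hsq)
  set a := arccos v₃ with ha
  have hcos : cos a = v₃ := cos_arccos hlt.le hgt.le
  have ha0 : 0 < a := arccos_pos.2 hgt
  have hsin : 0 ≤ sin a := sin_nonneg_of_nonneg_of_le_pi ha0.le (arccos_le_pi _)
  have hs2 : sin a ^ 2 = 1 - v₃ ^ 2 := by rw [← hcos]; linear_combination sin_sq_add_cos_sq a
  have h3 : √3 ^ 2 = (3 : ℝ) := sq_sqrt (by norm_num)
  have hv2 : v₂ + v₃ / 2 = √3 / 2 * sin a := by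
    refine (sq_eq_sq₀ (by linarith) (by positivity)).1 ?_
    rw [mul_pow, div_pow, h3, hs2]
    linear_combination q23
  have e2 : v₂ = cos (2 * π / 3 - a) := by
    rw [cos_sub, cos_two_pi_div_three, sin_two_pi_div_three, hcos]
    linarith
  have e1 : v₁ = cos (2 * π / 3 + a) := by
    rw [cos_add, cos_two_pi_div_three, sin_two_pi_div_three, hcos]
    linarith
  refine ⟨a, ha0, ?_, hcos.symm, e2, e1⟩
  -- For a ≥ π/3 the angle 2π/3 - a is no larger than a in absolute value, contradicting v₂ < v₃.
  by_contra hle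
  have h4 : |2 * π / 3 - a| ≤ a := abs_le.2 ⟨by linarith [pi_pos], by linarith⟩
  have h5 := cos_le_cos_of_nonneg_of_le_pi (abs_nonneg _) (arccos_le_pi v₃) h4
  rw [cos_abs, ← e2, hcos] at h5
  linarith

theorem exists_eq_angleBranchPoints {b : Fin 4 → ℝ} (hb : StrictMono b) (hb0 : 0 < b 0)
    (h : IsHyperellipticTangentialCover b 3) :
    ∃ M a, 0 < M ∧ 0 < a ∧ a < π / 3 ∧ b = angleBranchPoints M a := by
  have hpos : ∀ k, 0 < b k := fun k => hb0.trans_le (hb.monotone (Fin.zero_le k))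
  have ht := strictMono_nodes hb hb0
  obtain ⟨ρ, s, γ, c, hs, hform⟩ := exists_form_of_tangentialCover b ht.injective hb.injective
    (fun k => (hpos k).ne') h
  have hδ : (-∏ k, (b k : ℂ)) ≠ 0 :=
    neg_ne_zero.2 (Finset.prod_ne_zero_iff.2 fun k _ => by exact_mod_cast (hpos k).ne')
  have hq := quadratic_relations ht hδ hs hform
  -- M is both the midpoint and the half-width of the outermost nodes 0 and 1/b₁, so x/M - 1 is the
  -- normalized centred coordinate.
  obtain ⟨M, hM⟩ : ∃ M, M = 1 / b 0 / 2 := ⟨_, rfl⟩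
  have hM0 : 0 < M := by rw [hM]; have := hpos 0; positivity
  have t0 : nodes b 0 = 0 := rfl
  have t4 : nodes b 4 = 2 * M := by rw [hM]; change 1 / b 0 = _; ring
  rw [t0, t4] at hq
  have hscale : ∀ x y : ℝ, (x - (0 + 2 * M) / 2) ^ 2 + (x - (0 + 2 * M) / 2) *
      (y - (0 + 2 * M) / 2) + (y - (0 + 2 * M) / 2) ^ 2 = 3 / 4 * ((2 * M - 0) / 2) ^ 2 →
      (x / M - 1) ^ 2 + (x / M - 1) * (y / M - 1) + (y / M - 1) ^ 2 = 3 / 4 := by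
    intro x y hxy
    field_simp
    linear_combination 4 * hxy
  have hlt : ∀ i j : Fin 5, i < j → nodes b i / M - 1 < nodes b j / M - 1 := by
    intro i j hij
    have := div_lt_div_of_pos_right (ht hij) hM0
    linarith
  obtain ⟨a, ha, ha', e3, e2, e1⟩ := exists_angle (hlt 1 2 (by decide)) (hlt 2 3 (by decide))
    (hscale _ _ (hq 1 2 (by decide) (by decide) (by decide) (by decide) (by decide)))
    (hscale _ _ (hq 1 3 (by decide) (by decide) (by decide) (by decide) (by decide)))
    (hscale _ _ (hq 2 3 (by decide) (by decide) (by decide) (by decide) (by decide)))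
  have key : ∀ (k : Fin 4) (φ : ℝ), 1 / b k / M - 1 = cos φ → b k = angleCoord M φ := by
    intro k φ hφ
    have hk := hpos k
    rw [angleCoord, ← hφ]
    field_simp
    ring
  refine ⟨M, a, hM0, ha, ha', ?_⟩
  funext k
  fin_cases k
  · refine key 0 0 ?_
    rw [cos_zero, hM]
    have := hpos 0
    field_simp
    norm_num
  · exact key 1 a e3
  · exact key 2 _ e2
  · exact key 3 _ e1

/-- For the last inequality, ω₁ = ω₂/λ with λ ≤ b₂ on the first interval and λ ≥ b₃ on the second:
∮_{α₂}ω₁ ≤ 2∮_{α₁}ω₂/b₃ < 2∮_{α₁}ω₂/b₂ ≤ 2∮_{α₁}ω₁. -/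
theorem alphaPeriod_relations {b : Fin 4 → ℝ} (hb : StrictMono b) (hb0 : 0 < b 0)
    (h : IsHyperellipticTangentialCover b 3) :
    0 < alphaPeriod b 0 1 ∧ alphaPeriod b 1 1 = 2 * alphaPeriod b 0 1 ∧
      alphaPeriod b 1 0 < 2 * alphaPeriod b 0 0 := by
  obtain ⟨M, a, hM, ha, ha', hba⟩ := exists_eq_angleBranchPoints hb hb0 h
  obtain ⟨i01, i23, hI⟩ := periods_angleBranchPoints hM ha ha' hba
  have h01 : b 0 < b 1 := hb (by decide)
  have h12 : b 1 < b 2 := hb (by decide)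
  have h23 : b 2 < b 3 := hb (by decide)
  set P : ℝ → ℝ := fun x => √(-(x * ∏ k, (x - b k))) with hP
  have hPpos : ∀ x ∈ Ioo (b 0) (b 1), 0 < P x := by
    intro x hx
    refine sqrt_pos.2 ?_
    rw [Fin.prod_univ_four]
    have e0 : 0 < x := hb0.trans hx.1
    have e1 : 0 < x - b 0 := by linarith [hx.1]
    have e2 : 0 < b 1 - x := by linarith [hx.2]
    have e3 : 0 < b 2 - x := by linarith [hx.2]
    have e4 : 0 < b 3 - x := by linarith [hx.2]
    have := mul_pos (mul_pos (mul_pos (mul_pos e0 e1) e2) e3) e4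
    linarith
  have hpos : 0 < ∫ x in (b 0)..(b 1), x ^ 1 / P x := by
    refine intervalIntegral.intervalIntegral_pos_of_pos_on i01 (fun x hx => ?_) h01
    exact div_pos (pow_pos (hb0.trans hx.1) 1) (hPpos x hx)
  have hinv : ∀ {u v : ℝ}, 0 < u → u < v →
      IntervalIntegrable (fun x => x ^ 1 / P x) volume u v →
      IntervalIntegrable (fun x => x ^ 0 / P x) volume u v := by
    intro u v hu huv hi
    have hc : ContinuousOn (fun x : ℝ => x⁻¹) (uIcc u v) := by
      refine continuousOn_inv₀.mono fun x hx => ?_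
      rw [uIcc_of_le huv.le] at hx
      exact (hu.trans_le hx.1).ne'
    refine (hi.continuousOn_mul hc).congr fun x hx => ?_
    rw [uIoc_of_le huv.le] at hx
    have : x ≠ 0 := (hu.trans hx.1).ne'
    simp only [pow_one, pow_zero]
    field_simp
  have hlow : (1 / b 1) * ∫ x in (b 0)..(b 1), x ^ 1 / P x ≤ ∫ x in (b 0)..(b 1), x ^ 0 / P x := by
    rw [← intervalIntegral.integral_const_mul]
    refine intervalIntegral.integral_mono_on h01.le (i01.const_mul _) (hinv hb0 h01 i01) ?_
    intro x hx
    have hb1 : 0 < b 1 := hb0.trans h01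
    rw [← mul_div_assoc, pow_one, pow_zero, one_div_mul_eq_div]
    have : x / b 1 ≤ 1 := (div_le_one hb1).2 hx.2
    exact div_le_div_of_nonneg_right this (sqrt_nonneg _)
  have hup : ∫ x in (b 2)..(b 3), x ^ 0 / P x ≤ (1 / b 2) * ∫ x in (b 2)..(b 3), x ^ 1 / P x := by
    have hb2 : 0 < b 2 := (hb0.trans h01).trans h12
    rw [← intervalIntegral.integral_const_mul]
    refine intervalIntegral.integral_mono_on h23.le (hinv hb2 h23 i23) (i23.const_mul _) ?_
    intro x hx
    rw [← mul_div_assoc, pow_one, pow_zero, one_div_mul_eq_div]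
    have : 1 ≤ x / b 2 := (one_le_div hb2).2 hx.1
    exact div_le_div_of_nonneg_right this (sqrt_nonneg _)
  have hfrac : 1 / b 2 < 1 / b 1 := one_div_lt_one_div_of_lt (hb0.trans h01) h12
  have a01 : alphaPeriod b 0 1 = 2 * ∫ x in (b 0)..(b 1), x ^ 1 / P x := rfl
  have a11 : alphaPeriod b 1 1 = 2 * ∫ x in (b 2)..(b 3), x ^ 1 / P x := rfl
  have a00 : alphaPeriod b 0 0 = 2 * ∫ x in (b 0)..(b 1), x ^ 0 / P x := rfl
  have a10 : alphaPeriod b 1 0 = 2 * ∫ x in (b 2)..(b 3), x ^ 0 / P x := rfl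
  rw [a01, a11, a00, a10]
  refine ⟨by linarith, by linarith, ?_⟩
  rw [hI] at hup
  nlinarith [mul_lt_mul_of_pos_right hfrac hpos]

/-! ### Application to geodesics -/

theorem strictMono_branchPoints {a₁ a₂ a₃ c : ℝ} (h₁₂ : a₁ < a₂) (h₂₃ : a₂ < a₃)
    (hc₁ : a₁ < c) (hc₃ : c < a₃) (hc₂ : c ≠ a₂) : StrictMono (branchPoints a₁ a₂ a₃ c) := by
  rw [Fin.strictMono_iff_lt_succ]
  intro i
  unfold branchPoints
  split_ifs with hc
  · fin_cases i <;> assumption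
  · have hc' : a₂ < c := lt_of_le_of_ne (not_lt.1 hc) hc₂.symm
    fin_cases i <;> assumption

end

end GeodesicCurve

theorem mainTheorem10 (a₁ a₂ a₃ c : ℝ) (h₀ : 0 < a₁) (h₁₂ : a₁ < a₂) (h₂₃ : a₂ < a₃)
    (hc₁ : a₁ < c) (hc₃ : c < a₃) (hc₂ : c ≠ a₂)
    (hΓ : GeodesicCurve.IsHyperellipticTangentialCover
      (GeodesicCurve.branchPoints a₁ a₂ a₃ c) 3) :
    GeodesicCurve.IsHill (GeodesicCurve.branchPoints a₁ a₂ a₃ c) ∧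
      (c < a₂ → GeodesicCurve.periodMapping a₁ a₂ a₃ c = 2) ∧
      (a₂ < c → GeodesicCurve.periodMapping a₁ a₂ a₃ c = 1 / 2) := by
  have hmono := GeodesicCurve.strictMono_branchPoints h₁₂ h₂₃ hc₁ hc₃ hc₂
  have hb0 : 0 < GeodesicCurve.branchPoints a₁ a₂ a₃ c 0 := by
    unfold GeodesicCurve.branchPoints
    split_ifs <;> exact h₀
  obtain ⟨hpos, hrel, hlt⟩ := GeodesicCurve.alphaPeriod_relations hmono hb0 hΓ
  -- The cycle 2α₁ - α₂ is dictated by ∮_{α₂}ω₂ = 2∮_{α₁}ω₂.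
  refine ⟨⟨![2, -1], ?_, 2 * GeodesicCurve.alphaPeriod _ 0 0 - GeodesicCurve.alphaPeriod _ 1 0,
    sub_pos.2 hlt, ?_, ?_⟩, fun hc => ?_, fun hc => ?_⟩
  · intro h
    have := congrFun h 0
    simp at this
  · simp [Fin.sum_univ_two]
    ring
  · simp [Fin.sum_univ_two]
    rw [hrel]
    ring
  · rw [GeodesicCurve.periodMapping, if_pos hc, hrel]
    field_simp
  · rw [GeodesicCurve.periodMapping, if_neg (not_lt.2 hc.le), hrel]
    field_simp
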